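/- Let $\mathbb F$ be the field with two elements and let all vector spaces be over $\mathbb F$. Let $\mathcal A$ be an $A_\infty$-algebra with underlying $\mathbb Z$-graded vector space $A$ and operations $\mu_i\colon A^{\otimes i}\to A$ of degree $2-i$ ($i\ge 1$). Let $\mathcal M$ be a right and $\mathcal N$ a left $A_\infty$-module over $\mathcal A$, with underlying spaces $M$, $N$ graded by cosets of $\mathbb Z$ in $\mathbb Q$ and operations $m_i\colon M\otimes A^{\otimes i-1}\to M$ and $m_i\colon A^{\otimes i-1}\otimes N\to N$ of degree $2-i$. The $A_\infty$ tensor product $\mathcal M\boxtimes\mathcal N$ is the complex $\bigoplus_{i\ge 0}M\otimes (A[1])^{\otimes i}\otimes N$, whose differential $\partial$ applies the operations of $\mathcal M$, $\mathcal A$, $\mathcal N$ in all possible ways to consecutive entries. It is filtered by $F_p=\bigoplus_{i\le p}M\otimes (A[1])^{\otimes i}\otimes N$. The Eilenberg–Moore spectral sequence is the spectral sequence of this filtration, $$E^r_{p,q}=\frac{Z^r_{p,q}}{Z^{r-1}_{p-1,q}+\partial Z^{r-1}_{p+r-1,q-1}},\qquad Z^r_{p,q}=\{c\in F_p:\ \deg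 c=q,\ \partial c\in F_{p-r}\},$$ with $d_r\colon E^r_{p,q}\to E^r_{p-r,q+1}$ induced by $\partial$. A chain $w$ represents an element of $E^r_{p,q}$ if that element is the class of some $c\in Z^r_{p,q}$ with $c-w\in F_{p-1}$. (A chain represents at most one element.) Massey products. Let $a_1,a_2,a_3$ be cycles with $\mu_1(s_1)=\mu_2(a_1,a_2)$ and $\mu_1(s_2)=\mu_2(a_2,a_3)$. The triple product $\langle a_1,a_2,a_3\rangle$ is represented by $$\mu_3(a_1,a_2,a_3)+\mu_2(s_1,a_3)+\mu_2(a_1,s_2).$$ Let $a_1,\dots,a_4$ be cycles with $\mu_1(s_i)=\mu_2(a_i,a_{i+1})$ for $i=1,2,3$ and $\mu_1(t_i)=\mu_3(a_i,a_{i+1},a_{i+2})+\mu_2(s_i,a_{i+2})+\mu_2(a_i,s_{i+1})$ for $i=1,2$. The fourfold product $\langle a_1,a_2,a_3,a_4\rangle$ is represented by $$\mu_4(a_1,a_2,a_3,a_4)+\mu_3(s_1,a_3,a_4)+\mu_3(a_1,s_2,a_4)+\mu_3(a_1,a_2,s_3)+\mu_2(t_1,a_4)+\mu_2(a_1,t_2)+\mu_2(s_1,s_3).$$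 The same formulas are used when the first entry lies in $M$ or the last one in $N$, with the operations of $\mathcal M$ or $\mathcal N$ in place of those of $\mathcal A$ wherever that entry, or a bounding chain in $M$ or $N$, is involved. Let $\mathbf x\in M$, $r_1,\dots,r_n\in A$, $\mathbf y\in N$ be homogeneous cycles. (1) Let $n\ge 2$ and suppose that all products of two consecutive terms of $\mathbf x,r_1,\dots,r_n,\mathbf y$ vanish in homology. Then homogeneous bounding chains $s_0\in M$, $s_1,\dots,s_{n-1}\in A$, $s_n\in N$ for these $n+1$ products exist, and $\mathbf x\otimes r_1\otimes\cdots\otimes r_n\otimes\mathbf y$ represents an element of the $E^2$-page. For every such choice of bounding chains, if all the triple Massey products below are represented by means of these same chains, then the following sum represents $d_2$ of that element in $E^2$: $$d_2[\mathbf x\otimes r_1\otimes\cdots\otimes r_n\otimes\mathbf y]=\Big[\langle\mathbf x,r_1,r_2\rangle\otimes r_3\otimes\cdots\otimes\mathbf y+\sum_{i=1}^{n-2}\mathbf x\otimes r_1\otimes\cdots\otimes\langle r_i,r_{i+1},r_{i+2}\rangle\otimes\cdots\otimes\mathbf y+\mathbf x\otimes r_1\otimes\cdots\otimes\langle r_{n-1},r_n,\mathbf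 y\rangle\Big].$$ (2) Let $n\ge 3$ and suppose that the fourfold Massey products of consecutive terms are simultaneously defined. That is, there is a choice of homogeneous bounding chains as in (1) for which the resulting representatives of all the triple Massey products of consecutive terms are boundaries of homogeneous chains. Then the element of $E^2$ represented by $\mathbf x\otimes r_1\otimes\cdots\otimes r_n\otimes\mathbf y$ satisfies $d_2=0$, and the same chain represents an element of the $E^3$-page. For every such choice of bounding chains of both kinds, with all the fourfold Massey products represented by means of these chains, the following sum represents $d_3$ of that element in $E^3$: $$d_3[\mathbf x\otimes r_1\otimes\cdots\otimes r_n\otimes\mathbf y]=\Big[\langle\mathbf x,r_1,r_2,r_3\rangle\otimes r_4\otimes\cdots\otimes\mathbf y+\sum_{i=1}^{n-3}\mathbf x\otimes r_1\otimes\cdots\otimes\langle r_i,r_{i+1},r_{i+2},r_{i+3}\rangle\otimes\cdots\otimes\mathbf y+\mathbf x\otimes r_1\otimes\cdots\otimes\langle r_{n-2},r_{n-1},r_n,\mathbf y\rangle\Big].$$ -/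

import Mathlib

open scoped TensorProduct DirectSum

noncomputable section

namespace AInf

/-- The ground field: the field with two elements. -/
abbrev F2 : Type := ZMod 2

/-! ### Families of multilinear operations evaluated on lists, and sums over splittings -/

section Lists

variable {A W : Type*} [AddCommGroup A] [Module F2 A] [AddCommGroup W] [Module F2 W]

/-- A family of `n`-linear maps `f n : A ^ n → W`, evaluated on a list:
`ev f [a₁, …, aₙ] = f n (a₁, …, aₙ)`. -/
def ev (f : ∀ n : ℕ, MultilinearMap F2 (fun _ : Fin n => A) W) (l : List A) : W :=
  f l.length l.get

/-- The sum of `f u v` over all ways to write the list `l` as `u ++ v`. -/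
def sum2 {α : Type*} (f : List α → List α → W) (l : List α) : W :=
  ∑ i ∈ Finset.range (l.length + 1), f (l.take i) (l.drop i)

/-- The sum of `f u v w` over all ways to write the list `l` as `u ++ v ++ w`. -/
def sum3 {α : Type*} (f : List α → List α → List α → W) (l : List α) : W :=
  sum2 (fun u t => sum2 (fun v w => f u v w) t) l

end Lists

/-! ### A-infinity algebras and modules -/

/-- An A-infinity algebra over the field with two elements: a `ℤ`-graded vector space with
operations `μ_n : A^{⊗ n} → A[2 - n]`, `n ≥ 1`, satisfying the A-infinity relations.
The index `n = 0` carries no operation (`μ 0 = 0`), so that in the relations only the splittings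
with a nonempty middle part contribute. -/
structure Algebra (A : Type*) [AddCommGroup A] [Module F2 A] where
  grade : ℤ → Submodule F2 A
  isInternal : DirectSum.IsInternal grade
  μ : ∀ n : ℕ, MultilinearMap F2 (fun _ : Fin n => A) A
  μ_zero : μ 0 = 0
  μ_mem : ∀ (n : ℕ) (d : Fin n → ℤ) (a : Fin n → A), (∀ i, a i ∈ grade (d i)) →
    μ n a ∈ grade (∑ i, d i + 2 - n)
  rel : ∀ l : List A, sum3 (fun u v w => ev μ (u ++ ev μ v :: w)) l = 0

/-- A right A-infinity module, graded by a coset of `ℤ` in `ℚ`.  The operation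
`m_{n+1} : M ⊗ A^{⊗ n} → M[2 - (n+1)]` is encoded as the `n`-linear map
`m n : A ^ n → End M`, i.e. `m_{n+1}(x, a₁, …, aₙ) = m n (a₁, …, aₙ) x`. -/
structure RightModule {A : Type*} [AddCommGroup A] [Module F2 A] (𝒜 : Algebra A)
    (M : Type*) [AddCommGroup M] [Module F2 M] where
  grade : ℚ → Submodule F2 M
  isInternal : DirectSum.IsInternal grade
  coset : ∃ c : ℚ, ∀ q : ℚ, grade q ≠ ⊥ → ∃ k : ℤ, q = c + k
  m : ∀ n : ℕ, MultilinearMap F2 (fun _ : Fin n => A) (M →ₗ[F2] M)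
  m_mem : ∀ (n : ℕ) (e : ℚ) (d : Fin n → ℤ) (x : M) (a : Fin n → A),
    x ∈ grade e → (∀ i, a i ∈ 𝒜.grade (d i)) →
    m n a x ∈ grade (e + (∑ i, d i : ℤ) + (1 - n))
  rel : ∀ (x : M) (l : List A),
    sum2 (fun u v => ev m v (ev m u x)) l
      + sum3 (fun u v w => ev m (u ++ ev 𝒜.μ v :: w) x) l = 0

/-- A left A-infinity module, graded by a coset of `ℤ` in `ℚ`.  The operation
`n_{k+1} : A^{⊗ k} ⊗ N → N[2 - (k+1)]` is encoded as the `k`-linear map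
`m k : A ^ k → End N`, i.e. `n_{k+1}(a₁, …, aₖ, y) = m k (a₁, …, aₖ) y`. -/
structure LeftModule {A : Type*} [AddCommGroup A] [Module F2 A] (𝒜 : Algebra A)
    (N : Type*) [AddCommGroup N] [Module F2 N] where
  grade : ℚ → Submodule F2 N
  isInternal : DirectSum.IsInternal grade
  coset : ∃ c : ℚ, ∀ q : ℚ, grade q ≠ ⊥ → ∃ k : ℤ, q = c + k
  m : ∀ n : ℕ, MultilinearMap F2 (fun _ : Fin n => A) (N →ₗ[F2] N)
  m_mem : ∀ (n : ℕ) (e : ℚ) (d : Fin n → ℤ) (y : N) (a : Fin n → A),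
    y ∈ grade e → (∀ i, a i ∈ 𝒜.grade (d i)) →
    m n a y ∈ grade (e + (∑ i, d i : ℤ) + (1 - n))
  rel : ∀ (y : N) (l : List A),
    sum2 (fun u v => ev m u (ev m v y)) l
      + sum3 (fun u v w => ev m (u ++ ev 𝒜.μ v :: w) y) l = 0

/-! ### The spectral sequence of a filtered complex -/

/-- A graded complex (differential of degree `1`) with an increasing filtration by subcomplexes. -/
structure FilteredComplex (V : Type*) [AddCommGroup V] [Module F2 V] where
  d : V →ₗ[F2] V
  d_d : ∀ v, d (d v) = 0
  fil : ℤ → Submodule F2 V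
  fil_mono : Monotone fil
  d_fil : ∀ p v, v ∈ fil p → d v ∈ fil p
  grade : ℚ → Submodule F2 V
  d_grade : ∀ q v, v ∈ grade q → d v ∈ grade (q + 1)

namespace FilteredComplex

variable {V : Type*} [AddCommGroup V] [Module F2 V] (C : FilteredComplex V)

/-- `Z^r_{p,q} = {c ∈ F_p | deg c = q, ∂ c ∈ F_{p-r}}`. -/
def Z (r p : ℤ) (q : ℚ) : Submodule F2 V :=
  C.fil p ⊓ C.grade q ⊓ (C.fil (p - r)).comap C.d

/-- The denominator `Z^{r-1}_{p-1,q} + ∂ Z^{r-1}_{p+r-1,q-1}` of the `r`-th page. -/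
def B (r p : ℤ) (q : ℚ) : Submodule F2 V :=
  C.Z (r - 1) (p - 1) q ⊔ (C.Z (r - 1) (p + r - 1) (q - 1)).map C.d

/-- The entry of the `r`-th page in filtration degree `p` and total degree `q`:
`E^r_{p,q} = Z^r_{p,q} / (Z^{r-1}_{p-1,q} + ∂ Z^{r-1}_{p+r-1,q-1})`. -/
abbrev Page (r p : ℤ) (q : ℚ) : Type _ :=
  C.Z r p q ⧸ (C.B r p q).submoduleOf (C.Z r p q)

theorem d_mem_Z {r p : ℤ} {q : ℚ} {c : V} (hc : c ∈ C.Z r p q) :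
    C.d c ∈ C.Z r (p - r) (q + 1) := by
  obtain ⟨⟨_, h2⟩, h3⟩ := hc
  exact ⟨⟨h3, C.d_grade _ _ h2⟩, by simp [C.d_d]⟩

theorem d_mem_B {r p : ℤ} {q : ℚ} {c : V} (hc : c ∈ C.B r p q) :
    C.d c ∈ C.B r (p - r) (q + 1) := by
  obtain ⟨a, ha, b, hb, rfl⟩ := Submodule.mem_sup.1 hc
  obtain ⟨b, _, rfl⟩ := hb
  rw [map_add, C.d_d, add_zero]
  refine Submodule.mem_sup_right ⟨a, ?_, rfl⟩
  have h1 : p - r + r - 1 = p - 1 := by ring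
  have h2 : q + 1 - 1 = q := by ring
  rw [h1, h2]
  exact ha

/-- The differential `d_r : E^r_{p,q} → E^r_{p-r,q+1}` induced by `∂`. -/
def dPage (r p : ℤ) (q : ℚ) : C.Page r p q →ₗ[F2] C.Page r (p - r) (q + 1) :=
  Submodule.mapQ _ _ (C.d.restrict fun _ hc => C.d_mem_Z hc) fun c hc => by
    have hc' : (c : V) ∈ C.B r p q := hc
    exact C.d_mem_B hc'

/-- The chain `w` represents the element `e` of `E^r_{p,q}`, where `E^r` is regarded as a
subquotient of the associated graded `F_p / F_{p-1}`: the element `e` is the class of some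
`c ∈ Z^r_{p,q}` with `c ≡ w` modulo `F_{p-1}`. -/
def Represents {r p : ℤ} {q : ℚ} (w : V) (e : C.Page r p q) : Prop :=
  ∃ c : C.Z r p q, Submodule.Quotient.mk c = e ∧ (c : V) - w ∈ C.fil (p - 1)

/-- A chain represents at most one element of a page. -/
theorem Represents.unique {r p : ℤ} {q : ℚ} {w : V} {e e' : C.Page r p q}
    (h : C.Represents w e) (h' : C.Represents w e') : e = e' := by
  obtain ⟨c, rfl, hc⟩ := h
  obtain ⟨c', rfl, hc'⟩ := h'
  rw [Submodule.Quotient.eq]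
  refine Submodule.mem_sup_left (T := (C.Z (r - 1) (p + r - 1) (q - 1)).map C.d) ?_
  have hs : (c : V) - c' ∈ C.Z r p q := (C.Z r p q).sub_mem c.2 c'.2
  have h1 : p - 1 - (r - 1) = p - r := by ring
  refine ⟨⟨?_, hs.1.2⟩, ?_⟩
  · have := (C.fil (p - 1)).sub_mem hc hc'
    simpa using this
  · rw [h1]; exact hs.2

end FilteredComplex

/-! ### Auxiliary facts on lists -/

section ListFacts

variable {W : Type*} [AddCommGroup W] {α : Type*}

theorem sum2_nil (f : List α → List α → W) : sum2 f [] = f [] [] := by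
  simp [sum2]

theorem sum2_cons (f : List α → List α → W) (a : α) (l : List α) :
    sum2 f (a :: l) = f [] (a :: l) + sum2 (fun u v => f (a :: u) v) l := by
  simp only [sum2, List.length_cons]
  rw [Finset.sum_range_succ']
  simp [add_comm]

theorem sum2_add (f g : List α → List α → W) (l : List α) :
    sum2 (fun u v => f u v + g u v) l = sum2 f l + sum2 g l := by
  simp [sum2, Finset.sum_add_distrib]

theorem sum2_map {W' : Type*} [AddCommGroup W'] (φ : W →+ W') (f : List α → List α → W)
    (l : List α) : φ (sum2 f l) = sum2 (fun u v => φ (f u v)) l := by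
  simp [sum2]

theorem sum2_congr {f g : List α → List α → W} {l : List α}
    (h : ∀ u v, u ++ v = l → f u v = g u v) : sum2 f l = sum2 g l := by
  refine Finset.sum_congr rfl fun i _ => h _ _ (by simp)

theorem sum2_comm {β : Type*} (f : List α → List α → List β → List β → W) (l : List α)
    (k : List β) :
    sum2 (fun u v => sum2 (fun p q => f u v p q) k) l
      = sum2 (fun p q => sum2 (fun u v => f u v p q) l) k :=
  Finset.sum_comm

theorem sum2_assoc (f : List α → List α → List α → W) (l : List α) :
    sum2 (fun s w => sum2 (fun u v => f u v w) s) l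
      = sum2 (fun u t => sum2 (fun v w => f u v w) t) l := by
  induction l generalizing f with
  | nil => simp [sum2_nil]
  | cons a l ih =>
    rw [sum2_cons, sum2_cons, sum2_cons, sum2_nil]
    simp only [sum2_cons, sum2_add]
    rw [ih (fun u v w => f (a :: u) v w)]
    abel

theorem sum2_append_cons (f : List α → List α → W) (u w : List α) (b : α) :
    sum2 f (u ++ b :: w) = sum2 (fun u₁ u₂ => f u₁ (u₂ ++ b :: w)) u
      + sum2 (fun w₁ w₂ => f (u ++ b :: w₁) w₂) w := by
  induction u generalizing f with
  | nil => simp [sum2_cons, sum2_nil]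
  | cons a u ih =>
    rw [List.cons_append, sum2_cons, sum2_cons, ih]
    simp [add_assoc]

theorem sum3_map {W' : Type*} [AddCommGroup W'] (φ : W →+ W')
    (f : List α → List α → List α → W) (l : List α) :
    φ (sum3 f l) = sum3 (fun u v w => φ (f u v w)) l := by
  simp [sum3, sum2_map]

theorem sum3_append_cons (f : List α → List α → List α → W) (u w : List α) (b : α) :
    sum3 f (u ++ b :: w)
      = sum3 (fun u₁ u₂ u₃ => f u₁ u₂ (u₃ ++ b :: w)) u
      + sum2 (fun u₁ u₂ => sum2 (fun w₁ w₂ => f u₁ (u₂ ++ b :: w₁) w₂) w) u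
      + sum3 (fun w₁ w₂ w₃ => f (u ++ b :: w₁) w₂ w₃) w := by
  simp only [sum3]
  rw [sum2_append_cons]
  simp only [sum2_append_cons, sum2_add]

theorem sum2_mem [Module F2 W] {S : Submodule F2 W} {f : List α → List α → W} {l : List α}
    (h : ∀ u v, u ++ v = l → f u v ∈ S) : sum2 f l ∈ S :=
  S.sum_mem fun _ _ => h _ _ (by simp)

theorem sum3_mem [Module F2 W] {S : Submodule F2 W} {f : List α → List α → List α → W}
    {l : List α} (h : ∀ u v w, u ++ (v ++ w) = l → f u v w ∈ S) : sum3 f l ∈ S :=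
  sum2_mem fun _ _ h1 => sum2_mem fun _ _ h2 => h _ _ _ (by rw [h2, h1])

theorem ofFn_update {n : ℕ} [DecidableEq (Fin n)] (v : Fin n → α) (i : Fin n) (a : α) :
    List.ofFn (Function.update v i a)
      = (List.ofFn v).take i ++ a :: (List.ofFn v).drop (i + 1) := by
  rw [← List.set_eq_take_cons_drop _ (by simp)]
  refine List.ext_getElem (by simp) fun k hk _ => ?_
  simp only [List.getElem_ofFn, List.getElem_set, Function.update_apply, Fin.ext_iff]
  grind

end ListFacts

section Multilinear

variable {A W : Type*} [AddCommGroup A] [AddCommGroup W]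

/-- Additivity of a function on lists in each entry; over the field with two elements this is
multilinearity. -/
def IsMultiadditive (f : List A → W) : Prop :=
  ∀ (u w : List A) (a b : A), f (u ++ (a + b) :: w) = f (u ++ a :: w) + f (u ++ b :: w)

theorem IsMultiadditive.zero {f : List A → W} (hf : IsMultiadditive f) (u w : List A) :
    f (u ++ 0 :: w) = 0 := by
  have := hf u w 0 0
  simpa using this

variable [Module F2 A] [Module F2 W]

/-- The `n`-linear map given by a multiadditive function on lists. -/
def multi (f : List A → W) (hf : IsMultiadditive f) (n : ℕ) :
    MultilinearMap F2 (fun _ : Fin n => A) W where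
  toFun v := f (List.ofFn v)
  map_update_add' v i a b := by simp only [ofFn_update]; exact hf _ _ _ _
  map_update_smul' v i c a := by
    simp only [ofFn_update]
    obtain rfl | rfl : c = 0 ∨ c = 1 := by revert c; decide
    · simp [hf.zero]
    · simp

theorem ev_ofFn (f : ∀ n : ℕ, MultilinearMap F2 (fun _ : Fin n => A) W) {n : ℕ}
    (v : Fin n → A) : ev f (List.ofFn v) = f n v := by
  have key : ∀ (l : List A) (n : ℕ) (h : l.length = n),
      f l.length l.get = f n (fun i => l.get (i.cast h.symm)) := by
    rintro l n rfl; rfl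
  rw [ev, key _ n (by simp)]
  congr 1
  funext i
  simp

theorem ev_multiadditive (f : ∀ n : ℕ, MultilinearMap F2 (fun _ : Fin n => A) W) :
    IsMultiadditive (ev f) := by
  intro u w a b
  have key : ∀ c : A, u ++ c :: w = List.ofFn
      (Function.update (u ++ (0 : A) :: w).get ⟨u.length, by simp⟩ c) := by
    intro c
    rw [ofFn_update, List.ofFn_get]
    simp
  rw [key, key a, key b, ev_ofFn, ev_ofFn, ev_ofFn, MultilinearMap.map_update_add]

theorem ev_multi (f : List A → W) (hf : IsMultiadditive f) (l : List A) :
    ev (multi f hf) l = f l := by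
  simp [ev, multi]

end Multilinear

/-! ### The A-infinity tensor product -/

section Box

variable {A : Type*} [AddCommGroup A] [Module F2 A]
  {M : Type*} [AddCommGroup M] [Module F2 M] {N : Type*} [AddCommGroup N] [Module F2 N]

variable (A M N) in
/-- The underlying vector space `⨁ₙ M ⊗ A^{⊗ n} ⊗ N` of the A-infinity tensor product. -/
def Box : Type _ := ⨁ n : ℕ, (M ⊗[F2] (⨂[F2]^n A)) ⊗[F2] N

instance : AddCommGroup (Box A M N) :=
  inferInstanceAs (AddCommGroup (⨁ n : ℕ, (M ⊗[F2] (⨂[F2]^n A)) ⊗[F2] N))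

instance : Module F2 (Box A M N) :=
  inferInstanceAs (Module F2 (⨁ n : ℕ, (M ⊗[F2] (⨂[F2]^n A)) ⊗[F2] N))

variable (A M N) in
/-- The inclusion of the summand `M ⊗ A^{⊗ n} ⊗ N`. -/
def boxOf (n : ℕ) : (M ⊗[F2] (⨂[F2]^n A)) ⊗[F2] N →ₗ[F2] Box A M N :=
  DirectSum.lof F2 ℕ (fun n : ℕ => (M ⊗[F2] (⨂[F2]^n A)) ⊗[F2] N) n

/-- The element `[x | a₁ | ⋯ | aₙ | y]`. -/
def word (x : M) (l : List A) (y : N) : Box A M N :=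
  boxOf A M N l.length ((x ⊗ₜ[F2] (PiTensorProduct.tprod F2 l.get)) ⊗ₜ[F2] y)

variable (A M N) in
/-- The elements `[x | a₁ | ⋯ | aₙ | y]` as multilinear maps. -/
def wordMulti (n : ℕ) :
    MultilinearMap F2 (fun _ : Fin n => A) (M →ₗ[F2] N →ₗ[F2] Box A M N) :=
  (TensorProduct.curry ((TensorProduct.mk F2 (M ⊗[F2] (⨂[F2]^n A)) N).compr₂
    (boxOf A M N n))).flip.compMultilinearMap
    (PiTensorProduct.tprod F2)

/-- `[x | l | y]` as a bilinear map in `x` and `y`. -/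
def wordHom (l : List A) : M →ₗ[F2] N →ₗ[F2] Box A M N := ev (wordMulti A M N) l

theorem wordHom_apply (l : List A) (x : M) (y : N) : wordHom l x y = word x l y := rfl

theorem wordHom_multiadditive :
    IsMultiadditive (wordHom : List A → M →ₗ[F2] N →ₗ[F2] Box A M N) :=
  ev_multiadditive _

/-- A linear map sends the summand of length `n` to `S` if it sends the words of length `n` to `S`. -/
theorem boxOf_mem_of_word {W : Type*} [AddCommGroup W] [Module F2 W] (g : Box A M N →ₗ[F2] W)
    (S : Submodule F2 W) (n : ℕ)
    (h : ∀ (x : M) (l : List A) (y : N), l.length = n → g (word x l y) ∈ S)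
    (t : (M ⊗[F2] (⨂[F2]^n A)) ⊗[F2] N) :
    g (boxOf A M N n t) ∈ S := by
  induction t using TensorProduct.induction_on with
  | zero => simp
  | add a b ha hb => rw [map_add, map_add]; exact S.add_mem ha hb
  | tmul s y =>
    induction s using TensorProduct.induction_on with
    | zero => simp
    | add a b ha hb => rw [TensorProduct.add_tmul, map_add, map_add]; exact S.add_mem ha hb
    | tmul x t =>
      induction t using PiTensorProduct.induction_on with
      | add a b ha hb =>
        rw [TensorProduct.tmul_add, TensorProduct.add_tmul, map_add, map_add]
        exact S.add_mem ha hb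
      | smul_tprod c a =>
        rw [TensorProduct.tmul_smul, ← TensorProduct.smul_tmul', map_smul, map_smul]
        refine S.smul_mem c ?_
        have := h x (List.ofFn a) y (by simp)
        rw [← wordHom_apply, wordHom, ev_ofFn] at this
        exact this

variable {𝒜 : Algebra A} (ℳ : RightModule 𝒜 M) (𝒩 : LeftModule 𝒜 N)

/-- The boundary of the word `[x | l | y]`, as a bilinear map in `x` and `y`:
`∑ [m(x, u) | v | y] + ∑ [x | u, μ(v), w | y] + ∑ [x | u | n(v, y)]`, the sums being over the
ways to write `l` as `u ++ v`, as `u ++ v ++ w`, and as `u ++ v`. -/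
def boundaryWord (l : List A) : M →ₗ[F2] N →ₗ[F2] Box A M N :=
  sum2 (fun u v => wordHom v ∘ₗ ev ℳ.m u) l
    + sum3 (fun u v w => wordHom (u ++ ev 𝒜.μ v :: w)) l
    + sum2 (fun u v => (wordHom u).compl₂ (ev 𝒩.m v)) l

theorem boundaryWord_apply (l : List A) (x : M) (y : N) :
    boundaryWord ℳ 𝒩 l x y =
      sum2 (fun u v => word (ev ℳ.m u x) v y) l
      + sum3 (fun u v w => word x (u ++ ev 𝒜.μ v :: w) y) l
      + sum2 (fun u v => word x u (ev 𝒩.m v y)) l := by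
  simp [boundaryWord, sum3, sum2, ← wordHom_apply]

theorem word_append_add (x : M) (u w : List A) (a b : A) (y : N) :
    word x (u ++ (a + b) :: w) y = word x (u ++ a :: w) y + word x (u ++ b :: w) y := by
  simp only [← wordHom_apply, wordHom_multiadditive u w a b, LinearMap.add_apply]

theorem word_append_zero (x : M) (u w : List A) (y : N) :
    word x (u ++ (0 : A) :: w) y = 0 := by
  rw [← wordHom_apply, wordHom_multiadditive.zero]; rfl

theorem word_add_left (x x' : M) (l : List A) (y : N) :
    word (x + x') l y = word x l y + word x' l y := by
  simp only [← wordHom_apply, map_add, LinearMap.add_apply]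

theorem word_add_right (x : M) (l : List A) (y y' : N) :
    word x l (y + y') = word x l y + word x l y' := by
  simp only [← wordHom_apply, map_add]

theorem boundaryWord_multiadditive : IsMultiadditive (boundaryWord ℳ 𝒩) := by
  intro u w a b
  have hm : ∀ u w x, ev ℳ.m (u ++ (a + b) :: w) x = _ := fun u w x =>
    LinearMap.congr_fun (ev_multiadditive ℳ.m u w a b) x
  have hn : ∀ u w y, ev 𝒩.m (u ++ (a + b) :: w) y = _ := fun u w y =>
    LinearMap.congr_fun (ev_multiadditive 𝒩.m u w a b) y
  have hμ : ∀ u w, ev 𝒜.μ (u ++ (a + b) :: w) = _ := fun u w => ev_multiadditive 𝒜.μ u w a b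
  have hw : ∀ (x : M) (u w : List A) (y : N), word x (u ++ (a + b) :: w) y = _ := fun x u w y =>
    word_append_add x u w a b y
  have e1 : ∀ (x : M) (p q r : List A) (c : A) (y : N),
      word x (p ++ c :: (q ++ (a + b) :: r)) y
        = word x (p ++ c :: (q ++ a :: r)) y + word x (p ++ c :: (q ++ b :: r)) y := by
    intro x p q r c y
    simpa using hw x (p ++ c :: q) r y
  have e2 : ∀ (x : M) (p q r : List A) (c : A) (y : N),
      word x ((p ++ (a + b) :: q) ++ c :: r) y
        = word x ((p ++ a :: q) ++ c :: r) y + word x ((p ++ b :: q) ++ c :: r) y := by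
    intro x p q r c y
    simpa using hw x p (q ++ c :: r) y
  have e3 : ∀ (x : M) (p q : List A) (c c' : A) (y : N), word x (p ++ (c + c') :: q) y
      = word x (p ++ c :: q) y + word x (p ++ c' :: q) y := fun x p q c c' y =>
    word_append_add x p q c c' y
  refine LinearMap.ext₂ fun x y => ?_
  simp only [boundaryWord_apply, LinearMap.add_apply, sum2_append_cons, sum3_append_cons]
  simp only [hm, hn, hμ, hw, e1, e2, e3, LinearMap.add_apply, word_add_left, word_add_right,
    sum3, sum2_add]
  abel

/-- The differential of the A-infinity tensor product, given on words by `boundaryWord`. -/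
def boundary : Box A M N →ₗ[F2] Box A M N :=
  DirectSum.toModule F2 ℕ (Box A M N) fun n =>
    TensorProduct.lift (TensorProduct.lift
      (PiTensorProduct.lift
        (multi (boundaryWord ℳ 𝒩) (boundaryWord_multiadditive ℳ 𝒩) n)).flip)

theorem boundary_word (x : M) (l : List A) (y : N) :
    boundary ℳ 𝒩 (word x l y) = boundaryWord ℳ 𝒩 l x y := by
  rw [boundary, word, boxOf]
  erw [DirectSum.toModule_lof]
  simp [multi]

/-- The filtration `F_p = ⨁_{n ≤ p} M ⊗ A^{⊗ n} ⊗ N`. -/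
def boxFil (A M N : Type*) [AddCommGroup A] [Module F2 A] [AddCommGroup M] [Module F2 M]
    [AddCommGroup N] [Module F2 N] (p : ℤ) : Submodule F2 (Box A M N) :=
  ⨆ (n : ℕ) (_ : (n : ℤ) ≤ p),
    LinearMap.range (boxOf A M N n)

theorem boxFil_mono : Monotone (boxFil A M N) := fun _ _ h =>
  iSup_le fun n => iSup_le fun hn => le_iSup₂_of_le n (hn.trans h) le_rfl

theorem word_mem_boxFil (x : M) (l : List A) (y : N) {p : ℤ} (h : (l.length : ℤ) ≤ p) :
    word x l y ∈ boxFil A M N p :=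
  (le_iSup₂_of_le (f := fun (n : ℕ) (_ : (n : ℤ) ≤ p) => LinearMap.range (boxOf A M N n))
    l.length h le_rfl) ⟨_, rfl⟩

theorem boundary_mem_boxFil (p : ℤ) (v : Box A M N) (hv : v ∈ boxFil A M N p) :
    boundary ℳ 𝒩 v ∈ boxFil A M N p := by
  suffices h : boxFil A M N p ≤ (boxFil A M N p).comap (boundary ℳ 𝒩) from h hv
  refine iSup₂_le fun n hn => ?_
  rintro _ ⟨t, rfl⟩
  refine boxOf_mem_of_word (boundary ℳ 𝒩) (boxFil A M N p) n (fun x l y hl => ?_) t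
  rw [boundary_word, boundaryWord_apply]
  refine Submodule.add_mem _ (Submodule.add_mem _ (sum2_mem fun u v h => ?_)
    (sum3_mem fun u v w h => ?_)) (sum2_mem fun u v h => ?_)
  · exact word_mem_boxFil _ _ _ (by subst h; simp at hl; omega)
  · rcases v with _ | ⟨a, v⟩
    · have h0 : ev 𝒜.μ [] = 0 := by
        change 𝒜.μ 0 _ = 0
        rw [𝒜.μ_zero]; rfl
      rw [h0, word_append_zero]
      exact Submodule.zero_mem _
    · exact word_mem_boxFil _ _ _ (by subst h; simp at hl ⊢; omega)
  · exact word_mem_boxFil _ _ _ (by subst h; simp at hl; omega)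

/-- Total degree in the A-infinity tensor product, where the tensor factors are shifted copies
`A[1]` of `A`: the word `[x | a₁ | ⋯ | aₙ | y]` of homogeneous elements has degree
`deg x + ∑ (deg aᵢ - 1) + deg y`. -/
def boxGrade (q : ℚ) : Submodule F2 (Box A M N) :=
  Submodule.span F2 {z | ∃ (e : ℚ) (ds : List ℤ) (e' : ℚ) (x : M) (l : List A) (y : N),
    x ∈ ℳ.grade e ∧ List.Forall₂ (fun a d => a ∈ 𝒜.grade d) l ds ∧ y ∈ 𝒩.grade e' ∧
    e + ((ds.map (fun d => d - 1)).sum : ℤ) + e' = q ∧ z = word x l y}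

theorem forall₂_get {l : List A} {ds : List ℤ}
    (h : List.Forall₂ (fun a d => a ∈ 𝒜.grade d) l ds) :
    ∃ d : Fin l.length → ℤ, (∀ i, l.get i ∈ 𝒜.grade (d i)) ∧ ∑ i, d i = ds.sum ∧
      ds.length = l.length := by
  have hl := h.length_eq
  refine ⟨fun i => ds.get (i.cast hl), fun i => ?_, ?_, hl.symm⟩
  · exact h.get i.2 (hl ▸ i.2)
  · rw [← Fin.sum_univ_getElem]
    exact Fintype.sum_equiv (finCongr hl) _ _ fun i => rfl

theorem μ_mem_list {l : List A} {ds : List ℤ}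
    (h : List.Forall₂ (fun a d => a ∈ 𝒜.grade d) l ds) :
    ev 𝒜.μ l ∈ 𝒜.grade (ds.sum + 2 - ds.length) := by
  obtain ⟨d, h1, h2, h3⟩ := forall₂_get h
  rw [← h2, h3]
  exact 𝒜.μ_mem _ d _ h1

theorem m_mem_list {l : List A} {ds : List ℤ}
    (h : List.Forall₂ (fun a d => a ∈ 𝒜.grade d) l ds) {x : M} {e : ℚ} (hx : x ∈ ℳ.grade e) :
    ev ℳ.m l x ∈ ℳ.grade (e + (ds.sum : ℤ) + (1 - ds.length)) := by
  obtain ⟨d, h1, h2, h3⟩ := forall₂_get h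
  rw [← h2, h3]
  exact ℳ.m_mem _ e d _ _ hx h1

theorem n_mem_list {l : List A} {ds : List ℤ}
    (h : List.Forall₂ (fun a d => a ∈ 𝒜.grade d) l ds) {y : N} {e : ℚ} (hy : y ∈ 𝒩.grade e) :
    ev 𝒩.m l y ∈ 𝒩.grade (e + (ds.sum : ℤ) + (1 - ds.length)) := by
  obtain ⟨d, h1, h2, h3⟩ := forall₂_get h
  rw [← h2, h3]
  exact 𝒩.m_mem _ e d _ _ hy h1

theorem sum_map_sub_one (ds : List ℤ) :
    (ds.map (fun d => d - 1)).sum = ds.sum - ds.length := by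
  induction ds with
  | nil => simp
  | cons a l ih => simp [ih]; ring

theorem forall₂_split {u v : List A} {ds : List ℤ}
    (h : List.Forall₂ (fun a d => a ∈ 𝒜.grade d) (u ++ v) ds) :
    ∃ d₁ d₂, ds = d₁ ++ d₂ ∧ List.Forall₂ (fun a d => a ∈ 𝒜.grade d) u d₁ ∧
      List.Forall₂ (fun a d => a ∈ 𝒜.grade d) v d₂ := by
  refine ⟨ds.take u.length, ds.drop u.length, by simp, ?_, ?_⟩
  · simpa using List.forall₂_take u.length h
  · simpa using List.forall₂_drop u.length h

theorem boundary_mem_boxGrade (q : ℚ) (z : Box A M N) (hz : z ∈ boxGrade ℳ 𝒩 q) :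
    boundary ℳ 𝒩 z ∈ boxGrade ℳ 𝒩 (q + 1) := by
  suffices h : boxGrade ℳ 𝒩 q ≤ (boxGrade ℳ 𝒩 (q + 1)).comap (boundary ℳ 𝒩) from h hz
  refine Submodule.span_le.2 ?_
  rintro _ ⟨e, ds, e', x, l, y, hx, hl, hy, hq, rfl⟩
  change boundary ℳ 𝒩 (word x l y) ∈ boxGrade ℳ 𝒩 (q + 1)
  rw [boundary_word, boundaryWord_apply]
  rw [sum_map_sub_one] at hq
  refine Submodule.add_mem _ (Submodule.add_mem _ (sum2_mem fun u v h => ?_)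
    (sum3_mem fun u v w h => ?_)) (sum2_mem fun u v h => ?_)
  · subst h
    obtain ⟨d₁, d₂, rfl, h1, h2⟩ := forall₂_split hl
    refine Submodule.subset_span ⟨_, d₂, e', _, v, y, m_mem_list ℳ h1 hx, h2, hy, ?_, rfl⟩
    rw [← hq, sum_map_sub_one]
    push_cast [List.sum_append, List.length_append]
    ring
  · subst h
    obtain ⟨d₁, d', rfl, h1, h'⟩ := forall₂_split hl
    obtain ⟨d₂, d₃, rfl, h2, h3⟩ := forall₂_split h'
    refine Submodule.subset_span ⟨e, d₁ ++ (_ :: d₃), e', x, _, y, hx,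
      List.rel_append h1 (List.Forall₂.cons (μ_mem_list h2) h3), hy, ?_, rfl⟩
    rw [← hq, sum_map_sub_one]
    push_cast [List.sum_append, List.length_append, List.sum_cons, List.length_cons]
    ring
  · subst h
    obtain ⟨d₁, d₂, rfl, h1, h2⟩ := forall₂_split hl
    refine Submodule.subset_span ⟨e, d₁, _, x, u, _, hx, h1, n_mem_list 𝒩 h2 hy, ?_, rfl⟩
    rw [← hq, sum_map_sub_one]
    push_cast [List.sum_append, List.length_append]
    ring

theorem sum2_swap {W : Type*} [AddCommGroup W] {α : Type*}
    (f : List α → List α → List α → List α → W) (l : List α) :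
    sum2 (fun u t => sum2 (fun v w => sum2 (fun a b => f a b v w) u) t) l
      = sum2 (fun a t => sum2 (fun b t' => sum2 (fun v w => f a b v w) t') t) l := by
  rw [← sum2_assoc (fun a b t' => sum2 (fun v w => f a b v w) t')]
  refine sum2_congr fun u t _ => ?_
  exact sum2_comm _ _ _

theorem boundary_boundary_word (x : M) (l : List A) (y : N) :
    boundary ℳ 𝒩 (boundary ℳ 𝒩 (word x l y)) = 0 := by
  have hB : ∀ (x : M) (l : List A) (y : N), boundary ℳ 𝒩 (word x l y) =
      sum2 (fun u v => word (ev ℳ.m u x) v y) l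
      + sum3 (fun u v w => word x (u ++ ev 𝒜.μ v :: w) y) l
      + sum2 (fun u v => word x u (ev 𝒩.m v y)) l := fun x l y => by
    rw [boundary_word, boundaryWord_apply]
  have hD2 := fun f (l : List A) => sum2_map (boundary ℳ 𝒩).toAddMonoidHom f l
  have hD3 := fun f (l : List A) => sum3_map (boundary ℳ 𝒩).toAddMonoidHom f l
  simp only [LinearMap.toAddMonoidHom_coe] at hD2 hD3
  -- the three families of cancelling terms coming from the structure relations
  have relM : sum2 (fun s q => sum2 (fun u p => word (ev ℳ.m p (ev ℳ.m u x)) q y) s) l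
      + sum2 (fun s q => sum3 (fun u v w => word (ev ℳ.m (u ++ ev 𝒜.μ v :: w) x) q y) s) l
      = 0 := by
    rw [← sum2_add]
    refine (sum2_congr (g := fun _ _ => 0) fun s q _ => ?_).trans (by simp [sum2])
    let φ : M →+ Box A M N := ((wordHom q).flip y).toAddMonoidHom
    have h2 := congrArg φ (ℳ.rel x s)
    rw [map_add, sum2_map, sum3_map, map_zero] at h2
    exact h2
  have relN : sum2 (fun p s => sum2 (fun u v => word x p (ev 𝒩.m u (ev 𝒩.m v y))) s) l
      + sum2 (fun p s => sum3 (fun u v w => word x p (ev 𝒩.m (u ++ ev 𝒜.μ v :: w) y)) s) l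
      = 0 := by
    rw [← sum2_add]
    refine (sum2_congr (g := fun _ _ => 0) fun p s _ => ?_).trans (by simp [sum2])
    let φ : N →+ Box A M N := (wordHom p x).toAddMonoidHom
    have h2 := congrArg φ (𝒩.rel y s)
    rw [map_add, sum2_map, sum3_map, map_zero] at h2
    exact h2
  have relA : sum3 (fun p s r => sum3 (fun u v w =>
      word x (p ++ ev 𝒜.μ (u ++ ev 𝒜.μ v :: w) :: r) y) s) l = 0 := by
    refine (sum2_congr (g := fun _ _ => 0) fun p t _ => ?_).trans (by simp [sum2])
    refine (sum2_congr (g := fun _ _ => 0) fun s r _ => ?_).trans (by simp [sum2])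
    let φ : A →+ Box A M N :=
      { toFun := fun a => word x (p ++ a :: r) y
        map_zero' := word_append_zero _ _ _ _
        map_add' := fun a b => word_append_add _ _ _ _ _ _ }
    have h2 := congrArg φ (𝒜.rel s)
    rw [sum3_map, map_zero] at h2
    exact h2
  rw [hB, map_add, map_add, hD2, hD3, hD2]
  simp only [hB]
  simp only [sum2_append_cons, sum3_append_cons]
  simp only [sum3, sum2_add] at relM relN relA ⊢
  simp only [sum2_assoc] at relM relN relA ⊢
  simp only [sum2_swap, List.append_assoc, List.cons_append]
  have key : ∀ a b c d f g h k j : Box A M N, a + d = 0 → g = 0 → j + h = 0 →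
      a + b + c + (b + d + (f + g + f) + (h + k)) + (c + k + j) = 0 := by
    intro a b c d f g h k j h1 h2 h3
    have e : a + b + c + (b + d + (f + g + f) + (h + k)) + (c + k + j)
        = (a + d) + (b + b) + (c + c) + (f + f) + g + (j + h) + (k + k) := by abel
    rw [e, h1, h2, h3]
    simp [ZModModule.add_self]
  exact key _ _ _ _ _ _ _ _ _ relM relA relN

theorem boundary_boundary (z : Box A M N) : boundary ℳ 𝒩 (boundary ℳ 𝒩 z) = 0 := by
  suffices h : (boundary ℳ 𝒩).comp (boundary ℳ 𝒩) = 0 from LinearMap.congr_fun h z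
  refine DirectSum.linearMap_ext (M := fun n : ℕ => (M ⊗[F2] (⨂[F2]^n A)) ⊗[F2] N) F2
    fun n => LinearMap.ext fun t => ?_
  have := boxOf_mem_of_word ((boundary ℳ 𝒩).comp (boundary ℳ 𝒩)) ⊥ n
    (fun x l y _ => by simp [boundary_boundary_word]) t
  have h : boundary ℳ 𝒩 (boundary ℳ 𝒩 (boxOf A M N n t)) = 0 := by simpa using this
  exact h

/-- The A-infinity tensor product of a right and a left A-infinity module over `𝒜`, as a complex
filtered by the number of factors of `A`.  Its spectral sequence is the Eilenberg-Moore spectral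
sequence. -/
def tensor : FilteredComplex (Box A M N) where
  d := boundary ℳ 𝒩
  d_d := boundary_boundary ℳ 𝒩
  fil := boxFil A M N
  fil_mono := boxFil_mono
  d_fil := boundary_mem_boxFil ℳ 𝒩
  grade := boxGrade ℳ 𝒩
  d_grade := boundary_mem_boxGrade ℳ 𝒩

end Box

/-! ### Massey products -/

section Massey

variable {A : Type*} [AddCommGroup A] [Module F2 A]
  {M : Type*} [AddCommGroup M] [Module F2 M] {N : Type*} [AddCommGroup N] [Module F2 N]
  {𝒜 : Algebra A}

/-- The chain representing the triple Massey product `⟨a₁, a₂, a₃⟩`, for chains with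
`μ₁ s₁ = μ₂(a₁, a₂)` and `μ₁ s₂ = μ₂(a₂, a₃)`. -/
def Algebra.massey3 (𝒜 : Algebra A) (a₁ a₂ a₃ s₁ s₂ : A) : A :=
  ev 𝒜.μ [a₁, a₂, a₃] + ev 𝒜.μ [s₁, a₃] + ev 𝒜.μ [a₁, s₂]

/-- The chain representing `⟨x, a₂, a₃⟩`, where the first entry lies in a right module. -/
def RightModule.massey3 (ℳ : RightModule 𝒜 M) (x : M) (a₂ a₃ : A) (s₁ : M) (s₂ : A) : M :=
  ev ℳ.m [a₂, a₃] x + ev ℳ.m [a₃] s₁ + ev ℳ.m [s₂] x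

/-- The chain representing `⟨a₁, a₂, y⟩`, where the last entry lies in a left module. -/
def LeftModule.massey3 (𝒩 : LeftModule 𝒜 N) (a₁ a₂ : A) (y : N) (s₁ : A) (s₂ : N) : N :=
  ev 𝒩.m [a₁, a₂] y + ev 𝒩.m [s₁] y + ev 𝒩.m [a₁] s₂

/-- The chain representing the fourfold Massey product `⟨a₁, a₂, a₃, a₄⟩`, for chains with
`μ₁ sᵢ = μ₂(aᵢ, aᵢ₊₁)` and `μ₁ tᵢ = massey3 aᵢ aᵢ₊₁ aᵢ₊₂ sᵢ sᵢ₊₁`. -/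
def Algebra.massey4 (𝒜 : Algebra A) (a₁ a₂ a₃ a₄ s₁ s₂ s₃ t₁ t₂ : A) : A :=
  ev 𝒜.μ [a₁, a₂, a₃, a₄] + ev 𝒜.μ [s₁, a₃, a₄] + ev 𝒜.μ [a₁, s₂, a₄] + ev 𝒜.μ [a₁, a₂, s₃]
    + ev 𝒜.μ [t₁, a₄] + ev 𝒜.μ [a₁, t₂] + ev 𝒜.μ [s₁, s₃]

/-- The chain representing `⟨x, a₂, a₃, a₄⟩`, where the first entry lies in a right module. -/
def RightModule.massey4 (ℳ : RightModule 𝒜 M) (x : M) (a₂ a₃ a₄ : A) (s₁ : M) (s₂ s₃ : A)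
    (t₁ : M) (t₂ : A) : M :=
  ev ℳ.m [a₂, a₃, a₄] x + ev ℳ.m [a₃, a₄] s₁ + ev ℳ.m [s₂, a₄] x + ev ℳ.m [a₂, s₃] x
    + ev ℳ.m [a₄] t₁ + ev ℳ.m [t₂] x + ev ℳ.m [s₃] s₁

/-- The chain representing `⟨a₁, a₂, a₃, y⟩`, where the last entry lies in a left module. -/
def LeftModule.massey4 (𝒩 : LeftModule 𝒜 N) (a₁ a₂ a₃ : A) (y : N) (s₁ s₂ : A) (s₃ : N)
    (t₁ : A) (t₂ : N) : N :=
  ev 𝒩.m [a₁, a₂, a₃] y + ev 𝒩.m [s₁, a₃] y + ev 𝒩.m [a₁, s₂] y + ev 𝒩.m [a₁, a₂] s₃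
    + ev 𝒩.m [t₁] y + ev 𝒩.m [a₁] t₂ + ev 𝒩.m [s₁] s₃

/-- The list `[rᵢ, rᵢ₊₁, …, rᵢ₊ₖ₋₁]` of `k` consecutive terms of a sequence. -/
def seg (r : ℕ → A) (i k : ℕ) : List A := (List.range' i k).map r

/-- Homogeneous cycles `x`, `r₁, …, rₙ`, `y`.  Only the values `r i`, `d i` with `1 ≤ i ≤ n`
are relevant. -/
structure CycleWord (ℳ : RightModule 𝒜 M) (𝒩 : LeftModule 𝒜 N) (n : ℕ) where
  x : M
  r : ℕ → A
  y : N
  dx : ℚ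
  d : ℕ → ℤ
  dy : ℚ
  x_mem : x ∈ ℳ.grade dx
  r_mem : ∀ i, 1 ≤ i → i ≤ n → r i ∈ 𝒜.grade (d i)
  y_mem : y ∈ 𝒩.grade dy
  x_cycle : ev ℳ.m [] x = 0
  r_cycle : ∀ i, 1 ≤ i → i ≤ n → ev 𝒜.μ [r i] = 0
  y_cycle : ev 𝒩.m [] y = 0

namespace CycleWord

variable {ℳ : RightModule 𝒜 M} {𝒩 : LeftModule 𝒜 N} {n : ℕ} (c : CycleWord ℳ 𝒩 n)

/-- The chain `[x | r₁ | ⋯ | rₙ | y]`. -/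
def chain : Box A M N := word c.x (seg c.r 1 n) c.y

/-- The total degree of `[x | r₁ | ⋯ | rₙ | y]`. -/
def degree : ℚ := c.dx + (∑ i ∈ Finset.Icc 1 n, (c.d i - 1) : ℤ) + c.dy

/-- All products of two consecutive terms of `x, r₁, …, rₙ, y` vanish in homology (for `n ≥ 1`),
i.e. they are boundaries. -/
structure ProductsVanish : Prop where
  left : ∃ s : M, ev ℳ.m [] s = ev ℳ.m [c.r 1] c.x
  mid : ∀ i, 1 ≤ i → i + 1 ≤ n → ∃ s : A, ev 𝒜.μ [s] = ev 𝒜.μ [c.r i, c.r (i + 1)]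
  right : ∃ s : N, ev 𝒩.m [] s = ev 𝒩.m [c.r n] c.y

/-- A common choice of homogeneous bounding chains for all products of two consecutive terms of
`x, r₁, …, rₙ, y`: `∂ sx = x r₁`, `∂ sᵢ = rᵢ rᵢ₊₁` for `1 ≤ i < n`, and `∂ sy = rₙ y`. -/
structure BoundingChains where
  sx : M
  s : ℕ → A
  sy : N
  sx_mem : sx ∈ ℳ.grade (c.dx + c.d 1 - 1)
  s_mem : ∀ i, 1 ≤ i → i + 1 ≤ n → s i ∈ 𝒜.grade (c.d i + c.d (i + 1) - 1)
  sy_mem : sy ∈ 𝒩.grade (c.d n + c.dy - 1)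
  sx_eq : ev ℳ.m [] sx = ev ℳ.m [c.r 1] c.x
  s_eq : ∀ i, 1 ≤ i → i + 1 ≤ n → ev 𝒜.μ [s i] = ev 𝒜.μ [c.r i, c.r (i + 1)]
  sy_eq : ev 𝒩.m [] sy = ev 𝒩.m [c.r n] c.y

namespace BoundingChains

variable {c} (S : c.BoundingChains)

/-- The representative of `⟨x, r₁, r₂⟩` given by the bounding chains. -/
def tripleLeft : M := ℳ.massey3 c.x (c.r 1) (c.r 2) S.sx (S.s 1)

/-- The representative of `⟨rᵢ, rᵢ₊₁, rᵢ₊₂⟩` given by the bounding chains. -/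
def triple (i : ℕ) : A := 𝒜.massey3 (c.r i) (c.r (i + 1)) (c.r (i + 2)) (S.s i) (S.s (i + 1))

/-- The representative of `⟨rₙ₋₁, rₙ, y⟩` given by the bounding chains. -/
def tripleRight : N := 𝒩.massey3 (c.r (n - 1)) (c.r n) c.y (S.s (n - 1)) S.sy

/-- The sum of the words in which a consecutive triple is replaced by its Massey product
(for `n ≥ 2`):
`⟨x,r₁,r₂⟩ ⊗ r₃ ⊗ ⋯ ⊗ y + ∑ᵢ x ⊗ ⋯ ⊗ ⟨rᵢ,rᵢ₊₁,rᵢ₊₂⟩ ⊗ ⋯ ⊗ y + x ⊗ ⋯ ⊗ rₙ₋₂ ⊗ ⟨rₙ₋₁,rₙ,y⟩`. -/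
def masseySum : Box A M N :=
  word S.tripleLeft (seg c.r 3 (n - 2)) c.y
    + ∑ i ∈ Finset.Icc 1 (n - 2),
        word c.x (seg c.r 1 (i - 1) ++ S.triple i :: seg c.r (i + 3) (n - (i + 2))) c.y
    + word c.x (seg c.r 1 (n - 2)) S.tripleRight

end BoundingChains

/-- A common choice of homogeneous bounding chains for all products of two consecutive terms and
for the resulting representatives of the triple Massey products of consecutive terms (`n ≥ 2`).
By such a choice all fourfold Massey products of consecutive terms are simultaneously defined. -/
structure SecondBoundingChains extends BoundingChains c where
  tx : M
  t : ℕ → A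
  ty : N
  tx_mem : tx ∈ ℳ.grade (c.dx + c.d 1 + c.d 2 - 2)
  t_mem : ∀ i, 1 ≤ i → i + 2 ≤ n →
    t i ∈ 𝒜.grade (c.d i + c.d (i + 1) + c.d (i + 2) - 2)
  ty_mem : ty ∈ 𝒩.grade (c.d (n - 1) + c.d n + c.dy - 2)
  tx_eq : ev ℳ.m [] tx = toBoundingChains.tripleLeft
  t_eq : ∀ i, 1 ≤ i → i + 2 ≤ n → ev 𝒜.μ [t i] = toBoundingChains.triple i
  ty_eq : ev 𝒩.m [] ty = toBoundingChains.tripleRight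

namespace SecondBoundingChains

variable {c} (T : c.SecondBoundingChains)

/-- The representative of `⟨x, r₁, r₂, r₃⟩` given by the bounding chains. -/
def quadrupleLeft : M :=
  ℳ.massey4 c.x (c.r 1) (c.r 2) (c.r 3) T.sx (T.s 1) (T.s 2) T.tx (T.t 1)

/-- The representative of `⟨rᵢ, rᵢ₊₁, rᵢ₊₂, rᵢ₊₃⟩` given by the bounding chains. -/
def quadruple (i : ℕ) : A :=
  𝒜.massey4 (c.r i) (c.r (i + 1)) (c.r (i + 2)) (c.r (i + 3))
    (T.s i) (T.s (i + 1)) (T.s (i + 2)) (T.t i) (T.t (i + 1))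

/-- The representative of `⟨rₙ₋₂, rₙ₋₁, rₙ, y⟩` given by the bounding chains. -/
def quadrupleRight : N :=
  𝒩.massey4 (c.r (n - 2)) (c.r (n - 1)) (c.r n) c.y
    (T.s (n - 2)) (T.s (n - 1)) T.sy (T.t (n - 2)) T.ty

/-- The sum of the words in which a consecutive quadruple is replaced by its fourfold Massey
product (for `n ≥ 3`). -/
def fourfoldMasseySum : Box A M N :=
  word T.quadrupleLeft (seg c.r 4 (n - 3)) c.y
    + ∑ i ∈ Finset.Icc 1 (n - 3),
        word c.x (seg c.r 1 (i - 1) ++ T.quadruple i :: seg c.r (i + 4) (n - (i + 3))) c.y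
    + word c.x (seg c.r 1 (n - 3)) T.quadrupleRight

end SecondBoundingChains

end CycleWord

end Massey

end AInf

end

noncomputable section

namespace AInf

/-! ### Sums over decompositions of a list into consecutive blocks -/

section BlockSum

variable {ι W : Type*} [AddCommGroup W]

/-! The bounding chains form a defining system. A run of one, two or three consecutive entries of
`x, r₁, …, rₙ, y` is assigned the entry itself, the chain `s` or the chain `t`, and every longer run
is assigned `0`. Let `C` be the sum of the words obtained by cutting the sequence into runs in all
possible ways (`totalChain`). Every run with more than one entry costs a tensor factor, so `C`
agrees with `[x | r₁ | ⋯ | rₙ | y]` modulo `F_{n-1}`.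

The differential feeds a group of neighbouring blocks of a word into one operation. If the run
covered by this group is fixed and the sum is taken over its cuts, the result is an element
depending only on the run, its curvature. Hence `∂C` is the sum of all words in which one run is
replaced by its curvature and the rest is cut arbitrarily (`boundary_totalChain`). This is
multilinearity and reindexing; the A-infinity relations enter only through `∂∂ = 0`.

The curvature of a single entry is its differential, hence zero. For runs of size two and three it
is the sum of the two sides of the equation imposed on `s` or `t`, hence zero in characteristic two.
If all curvatures up to size `r` vanish, then `∂C` lies in `F_{n-r}`. Modulo `F_{n-r-1}` only the
words survive whose curved run has size exactly `r + 1` and whose other runs are single entries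
(`boundary_totalChain_sub_mem_boxFil`). The curvature of a run of size `r + 1` carrying no chain of
its own is the chosen representative of its Massey product. Taking `r = 2` with all `t` zero gives
`d₂`; taking `r = 3` gives `d₃`. In the second case `∂C ∈ F_{n-3}` also forces `d₂ = 0`.

Homogeneous bounding chains exist because `∂` has degree one, and the class does not depend on the
choices because a chain represents at most one element of a page. -/

theorem sum2_map_list {α β : Type*} (g : α → β) (f : List β → List β → W) (l : List α) :
    sum2 f (l.map g) = sum2 (fun u v => f (u.map g) (v.map g)) l := by
  simp [sum2, List.map_take, List.map_drop]

theorem sum3_map_list {α β : Type*} (g : α → β) (f : List β → List β → List β → W)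
    (l : List α) :
    sum3 f (l.map g) = sum3 (fun u v w => f (u.map g) (v.map g) (w.map g)) l := by
  simp [sum3, sum2_map_list]

theorem sum3_congr {α : Type*} {f g : List α → List α → List α → W} {l : List α}
    (h : ∀ u v w, u ++ (v ++ w) = l → f u v w = g u v w) : sum3 f l = sum3 g l :=
  sum2_congr fun u _ ht => sum2_congr fun v w hs => h u v w (by rw [hs, ht])

theorem sum3_add {α : Type*} (f g : List α → List α → List α → W) (l : List α) :
    sum3 (fun u v w => f u v w + g u v w) l = sum3 f l + sum3 g l := by
  simp [sum3, sum2_add]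

/-- Up to an element of `K`, a sum over splittings is given by its term with first part of
length `k`, if all other terms lie in `K`. -/
theorem sum2_sub_mem {α : Type*} (K : AddSubgroup W) {f : List α → List α → W} {l : List α}
    {k : ℕ} (hk : k ≤ l.length) (h : ∀ u v, u ++ v = l → u.length ≠ k → f u v ∈ K) :
    sum2 f l - f (l.take k) (l.drop k) ∈ K := by
  rw [sum2, ← Finset.sum_erase_add _ _ (Finset.mem_range.2 (Nat.lt_succ_of_le hk)),
    add_sub_cancel_right]
  refine K.sum_mem fun i hi => h _ _ (by simp) ?_
  simp only [Finset.mem_erase, Finset.mem_range] at hi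
  rw [List.length_take]
  omega

/-- Up to an element of `K`, a sum over splittings in three parts is given by its terms with
middle part of length `k`, if all other terms lie in `K`. -/
theorem sum3_sub_mem {α : Type*} (K : AddSubgroup W) {f : List α → List α → List α → W}
    {l : List α} (k : ℕ) (h : ∀ u v w, u ++ (v ++ w) = l → v.length ≠ k → f u v w ∈ K) :
    sum3 f l - ∑ i ∈ Finset.range (l.length + 1 - k),
      f (l.take i) ((l.drop i).take k) (l.drop (i + k)) ∈ K := by
  -- A first part of length `i > l.length - k` leaves fewer than `k` entries, so there is no middle
  -- part of length `k`; all such terms lie in `K`.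
  rw [sum3, sum2, ← Finset.sum_range_add_sum_Ico _ (Nat.sub_le (l.length + 1) k),
    add_sub_right_comm, ← Finset.sum_sub_distrib]
  refine K.add_mem (K.sum_mem fun i hi => ?_) (K.sum_mem fun i hi => K.sum_mem fun j hj => ?_)
  · rw [Finset.mem_range] at hi
    rw [← List.drop_drop]
    refine sum2_sub_mem K (by rw [List.length_drop]; omega) fun v w hvw hv => h _ _ _ ?_ hv
    rw [hvw, List.take_append_drop]
  · rw [Finset.mem_Ico] at hi
    rw [Finset.mem_range, List.length_drop] at hj
    refine h _ _ _ (by simp) ?_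
    rw [List.length_take, List.length_drop]
    omega

/-- The sum of `f [u₁, …, uₖ]` over all ways to write the list `l` as `u₁ ++ ⋯ ++ uₖ` with
nonempty blocks `uᵢ`. -/
def blockSum (f : List (List ι) → W) : List ι → W
  | [] => f []
  -- The head either is a block of its own or is glued to the first block of a decomposition of the
  -- tail; the empty decomposition offers nothing to glue to.
  | a :: l => blockSum (fun p => f ([a] :: p) +
      match p with
      | [] => 0
      | q :: p => f ((a :: q) :: p)) l

@[simp] theorem blockSum_nil (f : List (List ι) → W) : blockSum f [] = f [] := rfl

theorem blockSum_add (f g : List (List ι) → W) (l : List ι) :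
    blockSum (fun p => f p + g p) l = blockSum f l + blockSum g l := by
  induction l generalizing f g with
  | nil => rfl
  | cons a l ih =>
    simp only [blockSum]
    rw [← ih]
    congr 1
    funext p
    rcases p with _ | ⟨q, p⟩
    · simp only [add_zero]
    · exact add_add_add_comm _ _ _ _

/-- The recursive definition decides for each entry whether to cut after it. Grouping the
decompositions by their whole first block gives the form needed for interchanging with `sum2`. -/
theorem blockSum_cons (f : List (List ι) → W) (a : ι) (l : List ι) :
    blockSum f (a :: l) = sum2 (fun u v => blockSum (fun p => f ((a :: u) :: p)) v) l := by
  induction l generalizing f a with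
  | nil => simp [blockSum, sum2_nil]
  | cons a' l ih =>
    rw [blockSum, ih, sum2_cons, ih]
    simp only [blockSum_add, sum2_add]

theorem blockSum_map {W' : Type*} [AddCommGroup W'] (φ : W →+ W') (f : List (List ι) → W)
    (l : List ι) : φ (blockSum f l) = blockSum (fun p => φ (f p)) l := by
  induction l generalizing f with
  | nil => rfl
  | cons a l ih =>
    simp only [blockSum, ih]
    congr 1
    funext p
    rcases p with _ | ⟨q, p⟩ <;> simp

theorem blockSum_congr {f g : List (List ι) → W} {l : List ι}
    (h : ∀ p, p.flatten = l → f p = g p) : blockSum f l = blockSum g l := by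
  induction l generalizing f g with
  | nil => exact h [] rfl
  | cons a l ih =>
    simp only [blockSum]
    refine ih fun p hp => ?_
    rw [h ([a] :: p) (by simp [hp])]
    rcases p with _ | ⟨q, p⟩
    · rfl
    · simp only
      rw [h _ (by simpa using hp)]

/-- Up to an element of `K`, a sum over block decompositions is given by the decomposition into
singletons, if all other terms lie in `K`. -/
theorem blockSum_sub_mem (K : AddSubgroup W) {f : List (List ι) → W} {l : List ι}
    (h : ∀ p, p.flatten = l → p.length < l.length → f p ∈ K) :
    blockSum f l - f (l.map fun a => [a]) ∈ K := by
  induction l generalizing f with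
  | nil => simp
  | cons a l ih =>
    have h1 := ih (f := fun p => f ([a] :: p))
      fun p hp hl => h _ (by simp [hp]) (by simpa using hl)
    have h2 : blockSum (fun p => match p with
      | [] => 0
      | q :: p => f ((a :: q) :: p)) l ∈ K := by
      rcases l with _ | ⟨b, l⟩
      · exact K.zero_mem
      -- The induction hypothesis sets aside the decomposition of the tail into singletons. After
      -- gluing `a` it contains a block of two entries, so it is not exceptional for the full list
      -- and lies in `K` as well (`h4`).
      · have h3 := ih (f := fun p => match p with
          | [] => 0
          | q :: p => f ((a :: q) :: p)) fun p hp hl => by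
            rcases p with _ | ⟨q, p⟩
            · exact K.zero_mem
            · exact h _ (by simpa using hp) (by simp at hl ⊢; omega)
        have h4 : f ((a :: [b]) :: l.map fun a => [a]) ∈ K :=
          h _ (by simp [← List.flatMap_def]) (by simp)
        have h5 := K.add_mem h3 h4
        simpa using h5
    rw [blockSum, blockSum_add, List.map_cons, add_sub_right_comm]
    exact K.add_mem h1 h2

theorem blockSum_mem (K : AddSubgroup W) {f : List (List ι) → W} {l : List ι}
    (h : ∀ p, p.flatten = l → p.length ≤ l.length → f p ∈ K) : blockSum f l ∈ K := by
  have h1 := blockSum_sub_mem K (f := f) (l := l) fun p hp hl => h p hp hl.le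
  have h2 : f (l.map fun a => [a]) ∈ K := h _ (by simp [← List.flatMap_def]) (by simp)
  simpa using K.add_mem h1 h2

@[simp] theorem blockSum_zero (l : List ι) : blockSum (fun _ => (0 : W)) l = 0 := by
  simpa using blockSum_mem (⊥ : AddSubgroup W) (f := fun _ : List (List ι) => (0 : W)) (l := l)
    fun _ _ _ => rfl

/-- Cutting the sequence of blocks in two is the same as cutting the list in two and decomposing
each half. Removing the first block shortens the list by an arbitrary amount, hence the strong
induction. -/
theorem blockSum_sum2 (g : List (List ι) → List (List ι) → W) (l : List ι) :
    blockSum (fun p => sum2 g p) l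
      = sum2 (fun u v => blockSum (fun p => blockSum (fun q => g p q) v) u) l := by
  induction hn : l.length using Nat.strong_induction_on generalizing l g with
  | _ n ih =>
    rcases l with _ | ⟨a, l⟩
    · simp [sum2_nil]
    · rw [blockSum_cons, sum2_cons, blockSum_nil, blockSum_cons]
      simp only [sum2_cons, blockSum_add, sum2_add]
      congr 1
      simp only [blockSum_cons]
      rw [sum2_assoc (fun u v w => blockSum (fun p => blockSum (fun q => g ((a :: u) :: p) q) w) v)]
      refine sum2_congr fun u v huv => ?_
      refine ih v.length ?_ _ _ rfl
      subst huv
      simp at hn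
      omega

theorem blockSum_comm {κ : Type*} (g : List (List ι) → List (List κ) → W)
    (l : List ι) (k : List κ) :
    blockSum (fun p => blockSum (fun q => g p q) k) l
      = blockSum (fun q => blockSum (fun p => g p q) l) k := by
  induction l generalizing g with
  | nil => rfl
  | cons a l ih =>
    simp only [blockSum]
    rw [← ih]
    congr 1
    funext p
    rcases p with _ | ⟨b, p⟩
    · simp
    · rw [← blockSum_add]

theorem blockSum_sum2_comm {α : Type*} (f : List α → List α → List (List ι) → W) (k : List α)
    (l : List ι) :
    blockSum (fun p => sum2 (fun v w => f v w p) k) l = sum2 (fun v w => blockSum (f v w) l) k := by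
  simp only [sum2]
  induction Finset.range (k.length + 1) using Finset.induction_on with
  | empty => simp
  | insert i s hi ih => simp only [Finset.sum_insert hi, blockSum_add, ih]

theorem blockSum_sum3 (g : List (List ι) → List (List ι) → List (List ι) → W) (l : List ι) :
    blockSum (fun p => sum3 g p) l
      = sum3 (fun u v w => blockSum (fun p => blockSum (fun q => blockSum (fun s => g p q s) w) v)
          u) l := by
  simp only [sum3]
  rw [blockSum_sum2]
  refine sum2_congr fun u t _ => ?_
  simp only [blockSum_sum2]
  exact blockSum_sum2_comm _ _ _

end BlockSum

/-! ### Defining systems in the A-infinity tensor product -/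

variable {A : Type*} [AddCommGroup A] [Module F2 A]
  {M : Type*} [AddCommGroup M] [Module F2 M] {N : Type*} [AddCommGroup N] [Module F2 N]
  {𝒜 : Algebra A}

/-! ### The boundary of the total chain in terms of curvatures -/

section Curvature

variable {ι : Type*} (ℳ : RightModule 𝒜 M) (𝒩 : LeftModule 𝒜 N)
  (bM : List ι → M) (bA : List ι → A) (bN : List ι → N)

variable (𝒜) in
/-- The sum of the operations of `𝒜` over all block decompositions of a list. -/
def curvature (v : List ι) : A := blockSum (fun p => ev 𝒜.μ (p.map bA)) v

/-- The sum of the operations of `ℳ` over all block decompositions of a list whose first block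
is a possibly empty block in `M`. -/
def leftCurvature (u : List ι) : M :=
  sum2 (fun u₁ u₂ => blockSum (fun p => ev ℳ.m (p.map bA) (bM u₁)) u₂) u

/-- The sum of the operations of `𝒩` over all block decompositions of a list whose last block
is a possibly empty block in `N`. -/
def rightCurvature (w : List ι) : N :=
  sum2 (fun w₁ w₂ => blockSum (fun p => ev 𝒩.m (p.map bA) (bN w₂)) w₁) w

/-- The sum of all words obtained from block decompositions of the list `L`. -/
def totalChain (L : List ι) : Box A M N :=
  sum3 (fun u v w => blockSum (fun p => word (bM u) (p.map bA) (bN w)) v) L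

/-- An operation consumes a run of adjacent blocks. Exchanging the sum over these runs with the sum
over decompositions leaves, for each covered sublist, the sum of the operations over all its
decompositions, which is its curvature. -/
theorem boundary_totalChain (L : List ι) :
    boundary ℳ 𝒩 (totalChain bM bA bN L)
      = sum3 (fun u v w => blockSum (fun p =>
            word (leftCurvature ℳ bM bA u) (p.map bA) (bN w)) v) L
        + sum3 (fun u v w => sum3 (fun v₁ v₂ v₃ => blockSum (fun p => blockSum (fun q =>
            word (bM u) (p.map bA ++ curvature 𝒜 bA v₂ :: q.map bA) (bN w)) v₃) v₁) v) L
        + sum3 (fun u v w => blockSum (fun p =>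
            word (bM u) (p.map bA) (rightCurvature 𝒩 bA bN w)) v) L := by
  have hD2 := fun f (l : List ι) => sum3_map (boundary ℳ 𝒩).toAddMonoidHom f l
  have hDb := fun f (l : List ι) => blockSum_map (boundary ℳ 𝒩).toAddMonoidHom f l
  simp only [LinearMap.toAddMonoidHom_coe] at hD2 hDb
  have hl : ∀ (u : List ι) (p : List A) (y : N),
      word (leftCurvature ℳ bM bA u) p y
        = sum2 (fun u₁ u₂ => blockSum (fun q =>
            word (ev ℳ.m (q.map bA) (bM u₁)) p y) u₂) u := fun u p y => by
    let φ : M →+ Box A M N := ((wordHom p).flip y).toAddMonoidHom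
    change φ (leftCurvature ℳ bM bA u) = _
    rw [leftCurvature, sum2_map]
    simp only [blockSum_map]
    rfl
  have hr : ∀ (w : List ι) (p : List A) (x : M),
      word x p (rightCurvature 𝒩 bA bN w)
        = sum2 (fun w₁ w₂ => blockSum (fun q =>
            word x p (ev 𝒩.m (q.map bA) (bN w₂))) w₁) w := fun w p x => by
    let φ : N →+ Box A M N := (wordHom p x).toAddMonoidHom
    change φ (rightCurvature 𝒩 bA bN w) = _
    rw [rightCurvature, sum2_map]
    simp only [blockSum_map]
    rfl
  -- A word is additive in each entry, so the sum defining a curvature can be pulled out of it; `hl`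
  -- and `hr` do the same at the two ends.
  have hm : ∀ (v : List ι) (p r : List A) (x : M) (y : N),
      word x (p ++ curvature 𝒜 bA v :: r) y
        = blockSum (fun q => word x (p ++ ev 𝒜.μ (q.map bA) :: r) y) v := fun v p r x y => by
    let φ : A →+ Box A M N :=
      { toFun := fun a => word x (p ++ a :: r) y
        map_zero' := word_append_zero _ _ _ _
        map_add' := fun a b => word_append_add _ _ _ _ _ _ }
    exact blockSum_map φ _ _
  have hb : ∀ u v w : List ι,
      boundary ℳ 𝒩 (blockSum (fun p => word (bM u) (p.map bA) (bN w)) v)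
      = sum2 (fun v₁ v₂ => blockSum (fun p => blockSum (fun q =>
            word (ev ℳ.m (q.map bA) (bM u)) (p.map bA) (bN w)) v₁) v₂) v
        + sum3 (fun v₁ v₂ v₃ => blockSum (fun p => blockSum (fun q =>
            word (bM u) (p.map bA ++ curvature 𝒜 bA v₂ :: q.map bA) (bN w)) v₃) v₁) v
        + sum2 (fun v₁ v₂ => blockSum (fun p => blockSum (fun q =>
            word (bM u) (p.map bA) (ev 𝒩.m (q.map bA) (bN w))) v₂) v₁) v := by
    intro u v w
    rw [hDb]
    simp only [boundary_word, boundaryWord_apply, sum2_map_list, sum3_map_list, blockSum_add]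
    rw [blockSum_sum2, blockSum_sum2, blockSum_sum3]
    congr 2
    · exact sum2_congr fun v₁ v₂ _ => blockSum_comm _ _ _
    · refine sum3_congr fun v₁ v₂ v₃ _ => blockSum_congr fun p _ => ?_
      rw [blockSum_comm]
      simp only [hm]
  rw [totalChain, hD2]
  simp only [hb, sum3_add, hl, hr]
  -- The initial blocks `v₁` fed into `bM u` become the second part of a longer left piece `u ++
  -- v₁`, and symmetrically on the right. Both identities are reassociations of splittings into four
  -- parts.
  refine congrArg₂ _ (congrArg₂ _ ?_ rfl) ?_
  · simp only [sum3, sum2_assoc, blockSum_sum2_comm, sum2_swap]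
  · simp only [sum3, sum2_assoc, blockSum_sum2_comm]

end Curvature

/-! ### Filtration and degree of the total chain -/

section Filtration

variable {ι : Type*} (ℳ : RightModule 𝒜 M) (𝒩 : LeftModule 𝒜 N)
  (bM : List ι → M) (bA : List ι → A) (bN : List ι → N)

theorem word_zero_left (l : List A) (y : N) : word (0 : M) l y = 0 := by
  simp [← wordHom_apply]

theorem word_zero_right (x : M) (l : List A) : word x l (0 : N) = 0 := by
  simp [← wordHom_apply]

/-- A sum of words over the block decompositions of a list `v` lies in filtration `v.length`. -/
theorem blockSum_word_mem_boxFil (v : List ι) (x : M) (y : N) {k : ℤ} (h : (v.length : ℤ) ≤ k) :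
    blockSum (fun p => word x (p.map bA) y) v ∈ boxFil A M N k :=
  blockSum_mem (boxFil A M N k).toAddSubgroup fun p _ hp =>
    word_mem_boxFil _ _ _ (by rw [List.length_map]; omega)

theorem blockSum_word_sub_mem_boxFil (v : List ι) (x : M) (y : N) {k : ℤ}
    (h : (v.length : ℤ) ≤ k + 1) :
    blockSum (fun p => word x (p.map bA) y) v - word x (v.map fun a => bA [a]) y
      ∈ boxFil A M N k := by
  have := blockSum_sub_mem (boxFil A M N k).toAddSubgroup
    (f := fun p => word x (p.map bA) y) (l := v) fun p _ hp =>
      word_mem_boxFil _ _ _ (by rw [List.length_map]; omega)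
  simpa [Function.comp_def] using this

theorem blockSum_blockSum_word_mem_boxFil (v w : List ι) (a : A) (x : M) (y : N) {k : ℤ}
    (h : (v.length + w.length + 1 : ℤ) ≤ k) :
    blockSum (fun p => blockSum (fun q => word x (p.map bA ++ a :: q.map bA) y) w) v
      ∈ boxFil A M N k :=
  blockSum_mem (boxFil A M N k).toAddSubgroup fun p _ hp =>
    blockSum_mem (boxFil A M N k).toAddSubgroup fun q _ hq =>
    word_mem_boxFil _ _ _ (by simp; omega)

/-- Only singletons on both sides of `a` reach the maximal length `v.length + w.length + 1`; any
larger block loses at least one factor. -/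
theorem blockSum_blockSum_word_sub_mem_boxFil (v w : List ι) (a : A) (x : M) (y : N) {k : ℤ}
    (h : (v.length + w.length : ℤ) ≤ k) :
    blockSum (fun p => blockSum (fun q => word x (p.map bA ++ a :: q.map bA) y) w) v
        - word x ((v.map fun i => bA [i]) ++ a :: w.map fun i => bA [i]) y
      ∈ boxFil A M N k := by
  have h1 := blockSum_sub_mem (boxFil A M N k).toAddSubgroup
    (f := fun p => blockSum (fun q => word x (p.map bA ++ a :: q.map bA) y) w) (l := v)
    fun p _ hp => blockSum_mem (boxFil A M N k).toAddSubgroup fun q _ hq =>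
      word_mem_boxFil _ _ _ (by simp; omega)
  have h2 := blockSum_sub_mem (boxFil A M N k).toAddSubgroup
    (f := fun q => word x ((v.map fun i => bA [i]) ++ a :: q.map bA) y) (l := w)
    fun q _ hq => word_mem_boxFil _ _ _ (by simp; omega)
  have h3 := (boxFil A M N k).toAddSubgroup.add_mem h1 h2
  simpa [Function.comp_def] using h3

/-- Up to lower filtration, the total chain of `L` is the word of singletons. -/
theorem totalChain_sub_mem_boxFil (L : List ι) :
    totalChain bM bA bN L - word (bM []) (L.map fun a => bA [a]) (bN [])
      ∈ boxFil A M N (L.length - 1) := by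
  set K := boxFil A M N (L.length - 1)
  have h1 := sum2_sub_mem K.toAddSubgroup (Nat.zero_le L.length)
    (f := fun u t => sum2 (fun v w => blockSum (fun p => word (bM u) (p.map bA) (bN w)) v) t)
    fun u t hut hu => sum2_mem (S := K) fun v w hvw =>
      blockSum_word_mem_boxFil _ _ _ _ (k := L.length - 1) (by
        subst hvw hut; simp only [List.length_append, Nat.cast_add] at hu ⊢; omega)
  have h2 := sum2_sub_mem K.toAddSubgroup le_rfl
    (f := fun v w => blockSum (fun p => word (bM []) (p.map bA) (bN w)) v) (l := L)
    fun v w hvw hv => blockSum_word_mem_boxFil _ _ _ _ (k := L.length - 1) (by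
      subst hvw; simp only [List.length_append, Nat.cast_add] at hv ⊢; omega)
  have h3 := blockSum_word_sub_mem_boxFil bA L (bM []) (bN []) (k := L.length - 1) (by simp)
  simp only [List.take_zero, List.drop_zero, List.take_length, List.drop_length] at h1 h2
  have := K.add_mem (K.add_mem h1 h2) h3
  simpa [totalChain, sum3] using this

theorem totalChain_mem_boxFil (L : List ι) :
    totalChain bM bA bN L ∈ boxFil A M N L.length := by
  refine sum3_mem fun u v w h => ?_
  subst h
  exact blockSum_word_mem_boxFil _ _ _ _ (by simp; omega)

/-- This excludes the insertion of a new factor between two blocks, which would raise the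
filtration. -/
theorem curvature_nil : curvature 𝒜 bA [] = 0 := by
  change 𝒜.μ 0 _ = 0
  rw [𝒜.μ_zero]
  rfl

/-- If all curvatures of blocks of size at most `r` vanish (where a block in `M` or `N` of a list
of length `k` has size `k + 1`), then the boundary of the total chain drops the filtration
by `r`. -/
theorem boundary_totalChain_mem_boxFil {L : List ι} {r : ℕ}
    (hM : ∀ u, u <+: L → u.length < r → leftCurvature ℳ bM bA u = 0)
    (hA : ∀ v, v <:+: L → v.length ≤ r → curvature 𝒜 bA v = 0)
    (hN : ∀ w, w <:+ L → w.length < r → rightCurvature 𝒩 bA bN w = 0) :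
    boundary ℳ 𝒩 (totalChain bM bA bN L) ∈ boxFil A M N (L.length - r) := by
  rw [boundary_totalChain]
  refine Submodule.add_mem _ (Submodule.add_mem _ (sum3_mem fun u v w h => ?_)
    (sum3_mem fun u v w h => sum3_mem fun v₁ v₂ v₃ hv => ?_)) (sum3_mem fun u v w h => ?_)
  · by_cases hu : u.length < r
    · simp [hM u ⟨v ++ w, h⟩ hu, word_zero_left]
    · exact blockSum_word_mem_boxFil _ _ _ _ (by subst h; simp; omega)
  · by_cases hu : v₂.length ≤ r
    · simp [hA v₂ ⟨u ++ v₁, v₃ ++ w, by rw [← h, ← hv]; simp⟩ hu, word_append_zero]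
    · exact blockSum_blockSum_word_mem_boxFil _ _ _ _ _ _ (by subst hv; subst h; simp; omega)
  · by_cases hu : w.length < r
    · simp [hN w ⟨u ++ v, by simpa using h⟩ hu, word_zero_right]
    · exact blockSum_word_mem_boxFil _ _ _ _ (by subst h; simp; omega)

/-- If all curvatures of blocks of size at most `r` vanish, then, up to lower filtration, the
boundary of the total chain is the sum of the words with one curvature of size `r + 1`, the
other blocks being singletons. -/
theorem boundary_totalChain_sub_mem_boxFil {L : List ι} {r : ℕ} (hr : r ≤ L.length)
    (hM : ∀ u, u <+: L → u.length < r → leftCurvature ℳ bM bA u = 0)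
    (hA : ∀ v, v <:+: L → v.length ≤ r → curvature 𝒜 bA v = 0)
    (hN : ∀ w, w <:+ L → w.length < r → rightCurvature 𝒩 bA bN w = 0) :
    boundary ℳ 𝒩 (totalChain bM bA bN L)
      - (word (leftCurvature ℳ bM bA (L.take r)) ((L.drop r).map fun a => bA [a]) (bN [])
        + ∑ i ∈ Finset.range (L.length - r), word (bM [])
            (((L.take i).map fun a => bA [a]) ++ curvature 𝒜 bA ((L.drop i).take (r + 1)) ::
              (L.drop (i + (r + 1))).map fun a => bA [a]) (bN [])
        + word (bM []) ((L.take (L.length - r)).map fun a => bA [a])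
            (rightCurvature 𝒩 bA bN (L.drop (L.length - r))))
      ∈ boxFil A M N (L.length - r - 1) := by
  rw [boundary_totalChain, add_sub_add_comm, add_sub_add_comm]
  set k : ℤ := L.length - r - 1 with hk
  set K := boxFil A M N k
  refine K.add_mem (K.add_mem ?_ ?_) ?_
  · have h1 := sum2_sub_mem K.toAddSubgroup hr
      (f := fun u t => sum2 (fun v w => blockSum (fun p =>
        word (leftCurvature ℳ bM bA u) (p.map bA) (bN w)) v) t)
      fun u t hut hu => sum2_mem (S := K) fun v w hvw => by
        by_cases hu' : u.length < r
        · simp [hM u ⟨t, hut⟩ hu', word_zero_left]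
        · exact blockSum_word_mem_boxFil _ _ _ _ (by subst hvw hut; simp at hk ⊢; omega)
    have h2 := sum2_sub_mem K.toAddSubgroup le_rfl (l := L.drop r)
      (f := fun v w => blockSum (fun p =>
        word (leftCurvature ℳ bM bA (L.take r)) (p.map bA) (bN w)) v)
      fun v w hvw hv => blockSum_word_mem_boxFil _ _ _ _ (by
        rw [← hvw] at hv
        have := congrArg List.length hvw
        simp only [List.length_append, List.length_drop] at hv this
        omega)
    have h3 := blockSum_word_sub_mem_boxFil bA (L.drop r) (leftCurvature ℳ bM bA (L.take r))
      (bN []) (k := k) (by simp; omega)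
    rw [List.take_length, List.drop_length] at h2
    have := K.add_mem (K.add_mem h1 h2) h3
    simpa [sum3] using this
  · let g := fun u v w => sum3 (fun v₁ v₂ v₃ => blockSum (fun p => blockSum (fun q =>
      word (bM u) (p.map bA ++ curvature 𝒜 bA v₂ :: q.map bA) (bN w)) v₃) v₁) v
    -- A curved middle block already costs `r` factors, so any entry absorbed into the outer blocks
    -- puts the word into `K`.
    have h0 : ∀ u v w, u ++ (v ++ w) = L → 0 < u.length + w.length → g u v w ∈ K := by
      intro u v w h hl
      refine sum3_mem fun v₁ v₂ v₃ hv => ?_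
      by_cases hu : v₂.length ≤ r
      · simp [hA v₂ ⟨u ++ v₁, v₃ ++ w, by rw [← h, ← hv]; simp⟩ hu, word_append_zero]
      · exact blockSum_blockSum_word_mem_boxFil _ _ _ _ _ _
          (by subst hv; subst h; simp at hk ⊢; omega)
    have h1 := sum2_sub_mem K.toAddSubgroup (Nat.zero_le L.length)
      (f := fun u t => sum2 (fun v w => g u v w) t)
      fun u t hut hu => sum2_mem (S := K) fun v w hvw =>
        h0 u v w (by rw [hvw, hut]) (by omega)
    have h2 := sum2_sub_mem K.toAddSubgroup le_rfl (f := fun v w => g [] v w) (l := L)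
      fun v w hvw hv => h0 [] v w hvw (by
        subst hvw; simp only [List.length_append] at hv ⊢; omega)
    -- With empty outer lists, a curved block of length at most `r` contributes zero and one of
    -- length above `r + 1` lands in `K`.
    have h3 := sum3_sub_mem K.toAddSubgroup (r + 1) (l := L)
      (f := fun v₁ v₂ v₃ => blockSum (fun p => blockSum (fun q =>
        word (bM []) (p.map bA ++ curvature 𝒜 bA v₂ :: q.map bA) (bN [])) v₃) v₁)
      fun u v w h hv => by
        by_cases hu : v.length ≤ r
        · simp [hA v ⟨u, w, by rw [← h]; simp⟩ hu, word_append_zero]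
        · exact blockSum_blockSum_word_mem_boxFil _ _ _ _ _ _
            (by subst h; simp at hk ⊢; omega)
    have h4 := K.sum_mem (t := Finset.range (L.length + 1 - (r + 1))) fun i hi =>
      blockSum_blockSum_word_sub_mem_boxFil bA (L.take i) (L.drop (i + (r + 1)))
        (curvature 𝒜 bA ((L.drop i).take (r + 1))) (bM []) (bN []) (k := k)
        (by simp at hi ⊢; omega)
    rw [Finset.sum_sub_distrib] at h4
    simp only [List.take_zero, List.drop_zero, List.take_length, List.drop_length] at h1 h2
    rw [Nat.add_sub_add_right] at h3 h4
    have := K.add_mem (K.add_mem h1 h2) (K.add_mem h3 h4)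
    rw [sub_add_sub_cancel, sub_add_sub_cancel] at this
    rw [sub_add_sub_cancel] at this
    exact this
  · have h1 := sum2_sub_mem K.toAddSubgroup (Nat.zero_le L.length)
      (f := fun u t => sum2 (fun v w => blockSum (fun p =>
        word (bM u) (p.map bA) (rightCurvature 𝒩 bA bN w)) v) t)
      fun u t hut hu => sum2_mem (S := K) fun v w hvw => by
        by_cases hw : w.length < r
        · simp [hN w ⟨u ++ v, by rw [← hut, ← hvw]; simp⟩ hw, word_zero_right]
        · exact blockSum_word_mem_boxFil _ _ _ _ (by
            subst hvw hut; simp only [List.length_append, Nat.cast_add] at hk hu ⊢; omega)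
    have h2 := sum2_sub_mem K.toAddSubgroup (Nat.sub_le L.length r) (l := L)
      (f := fun v w => blockSum (fun p =>
        word (bM []) (p.map bA) (rightCurvature 𝒩 bA bN w)) v)
      fun v w hvw hv => by
        by_cases hw : w.length < r
        · simp [hN w ⟨v, hvw⟩ hw, word_zero_right]
        · exact blockSum_word_mem_boxFil _ _ _ _ (by subst hvw; simp at hk hv ⊢; omega)
    have h3 := blockSum_word_sub_mem_boxFil bA (L.take (L.length - r)) (bM [])
      (rightCurvature 𝒩 bA bN (L.drop (L.length - r))) (k := k) (by simp; omega)
    simp only [List.take_zero, List.drop_zero] at h1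
    have := K.add_mem (K.add_mem h1 h2) h3
    simpa [sum3] using this

/-- The weight of an entry stands for its degree in `A[1]`. The `+ 1` undoes the shift once for each
block in `A`, so all words of the sum have the same total degree, however the list is cut. -/
theorem totalChain_mem_boxGrade {L : List ι} {dx : ℚ} {wt : ι → ℤ} {dy : ℚ}
    (hM : ∀ u, u <+: L → bM u ∈ ℳ.grade (dx + (u.map wt).sum))
    (hA : ∀ v, v <:+: L → bA v ∈ 𝒜.grade ((v.map wt).sum + 1))
    (hN : ∀ w, w <:+ L → bN w ∈ 𝒩.grade (dy + (w.map wt).sum)) :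
    totalChain bM bA bN L ∈ boxGrade ℳ 𝒩 (dx + (L.map wt).sum + dy) := by
  refine sum3_mem fun u v w h => ?_
  refine blockSum_mem (boxGrade ℳ 𝒩 _).toAddSubgroup fun p hp _ => Submodule.subset_span
    ⟨_, p.map fun q => (q.map wt).sum + 1, _, _, _, _, hM u ⟨v ++ w, h⟩, ?_,
      hN w ⟨u ++ v, by simpa using h⟩, ?_, rfl⟩
  · rw [List.forall₂_map_left_iff, List.forall₂_map_right_iff, List.forall₂_same]
    intro q hq
    refine hA q ((List.infix_of_mem_flatten hq).trans ⟨u, w, ?_⟩)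
    rw [hp, ← h, List.append_assoc]
  · subst h hp
    simp only [List.map_map, Function.comp_def, add_sub_cancel_right, List.map_append,
      List.sum_append, List.map_flatten, List.sum_flatten]
    push_cast
    ring

end Filtration

/-! ### From chains to pages, and homogeneous preimages -/

theorem FilteredComplex.exists_represents {V : Type*} [AddCommGroup V] [Module F2 V]
    (C : FilteredComplex V) {r p : ℤ} {q : ℚ} {c w v : V} (hp : c ∈ C.fil p) (hq : c ∈ C.grade q)
    (hd : C.d c ∈ C.fil (p - r)) (hw : c - w ∈ C.fil (p - 1))
    (hv : C.d c - v ∈ C.fil (p - r - 1)) :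
    ∃ e : C.Page r p q, C.Represents w e ∧ C.Represents v (C.dPage r p q e) :=
  ⟨Submodule.Quotient.mk ⟨c, ⟨hp, hq⟩, hd⟩, ⟨_, rfl, hw⟩, _, rfl, hv⟩

/-- The differential of a page vanishes on the class of a chain whose boundary lies one step
deeper in the filtration than required. -/
theorem FilteredComplex.exists_represents_dPage_eq_zero {V : Type*} [AddCommGroup V] [Module F2 V]
    (C : FilteredComplex V) {r p : ℤ} {q : ℚ} {c w : V} (hp : c ∈ C.fil p) (hq : c ∈ C.grade q)
    (hd : C.d c ∈ C.fil (p - r - 1)) (hw : c - w ∈ C.fil (p - 1)) :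
    ∃ e : C.Page r p q, C.Represents w e ∧ C.dPage r p q e = 0 := by
  -- The boundary is a cycle in `F_{p-r-1}`, hence belongs to the first summand
  -- `Z^{r-1}_{p-r-1,q+1}` of the denominator.
  refine ⟨Submodule.Quotient.mk ⟨c, ⟨hp, hq⟩, C.fil_mono (by omega) hd⟩, ⟨_, rfl, hw⟩,
    (Submodule.Quotient.mk_eq_zero _).2 (Submodule.mem_sup_left (S := C.Z _ _ _) ?_)⟩
  exact ⟨⟨hd, C.d_grade _ _ hq⟩, by simp [C.d_d]⟩

/-- A linear map of degree `k`: a homogeneous element of the image has a homogeneous preimage. -/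
theorem exists_homogeneous_preimage {ι V : Type*} [DecidableEq ι] [AddCommGroup ι]
    [AddCommGroup V] [Module F2 V] {G : ι → Submodule F2 V} (hG : DirectSum.IsInternal G)
    (f : V →ₗ[F2] V) {k : ι} (hf : ∀ i v, v ∈ G i → f v ∈ G (i + k)) {i : ι} {s : V}
    (hs : f s ∈ G (i + k)) : ∃ s' ∈ G i, f s' = f s := by
  let _ := hG.chooseDecomposition
  -- Since `f` has degree `k`, it commutes with taking homogeneous components; the component of `s`
  -- in degree `i` is then the required preimage.
  have key : ∀ v, (DirectSum.decompose G (f v) (i + k) : V) = f (DirectSum.decompose G v i) := by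
    intro v
    induction v using DirectSum.Decomposition.inductionOn G with
    | zero => simp
    | @homogeneous j m =>
      by_cases h : j = i
      · subst h
        rw [DirectSum.decompose_of_mem_same _ (hf _ _ m.2),
          DirectSum.decompose_of_mem_same _ m.2]
      · rw [DirectSum.decompose_of_mem_ne _ (hf _ _ m.2) (by simpa using h),
          DirectSum.decompose_of_mem_ne _ m.2 h, map_zero]
    | add a b ha hb => simp [DirectSum.decompose_add, ha, hb]
  exact ⟨_, (DirectSum.decompose G s i).2, by
    rw [← key, DirectSum.decompose_of_mem_same _ hs]⟩

/-! ### Curvatures of short blocks as Massey products -/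

section Blocks

theorem ev_cons_zero_nil : ev 𝒜.μ [0] = 0 := (ev_multiadditive 𝒜.μ).zero [] []

/-- The blocks of length one, two and three given by three sequences. -/
def blockA (r s t : ℕ → A) : List ℕ → A
  | [i] => r i
  | [i, _] => s i
  | [i, _, _] => t i
  | _ => 0

/-- The blocks in a module containing at most two further entries. -/
def blockM (x s t : M) : List ℕ → M
  | [] => x
  | [_] => s
  | [_, _] => t
  | _ => 0

variable {ℳ : RightModule 𝒜 M} {𝒩 : LeftModule 𝒜 N} (r s t : ℕ → A) (x sx tx : M)
  (y sy ty : N) (i : ℕ)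

theorem curvature_blockA_one : curvature 𝒜 (blockA r s t) [i] = ev 𝒜.μ [r i] := by
  simp [curvature, blockSum, blockA]

/-- The two cuts of a pair give the two sides of the equation bounding the product by `s`, so in
characteristic two this curvature vanishes exactly when the equation holds. The triple plays the
same role for `t`. -/
theorem curvature_blockA_two : curvature 𝒜 (blockA r s t) [i, i + 1]
    = ev 𝒜.μ [r i, r (i + 1)] + ev 𝒜.μ [s i] := by
  simp [curvature, blockSum, blockA]

theorem curvature_blockA_three : curvature 𝒜 (blockA r s t) [i, i + 1, i + 2]
    = 𝒜.massey3 (r i) (r (i + 1)) (r (i + 2)) (s i) (s (i + 1)) + ev 𝒜.μ [t i] := by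
  simp [curvature, blockSum, blockA, Algebra.massey3]
  abel

/-- Of the eight cuts, the uncut block contributes `μ₁(0)`; the other seven are the terms of the
fourfold product. -/
theorem curvature_blockA_four : curvature 𝒜 (blockA r s t) [i, i + 1, i + 2, i + 3]
    = 𝒜.massey4 (r i) (r (i + 1)) (r (i + 2)) (r (i + 3)) (s i) (s (i + 1)) (s (i + 2))
      (t i) (t (i + 1)) := by
  simp [curvature, blockSum, blockA, Algebra.massey4, ev_cons_zero_nil]
  abel

theorem leftCurvature_zero :
    leftCurvature ℳ (blockM x sx tx) (blockA r s t) [] = ev ℳ.m [] x := by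
  simp [leftCurvature, sum2_nil, blockM]

theorem leftCurvature_one :
    leftCurvature ℳ (blockM x sx tx) (blockA r s t) [i] = ev ℳ.m [r i] x + ev ℳ.m [] sx := by
  simp [leftCurvature, sum2_nil, sum2_cons, blockM, blockA, blockSum]

theorem leftCurvature_two :
    leftCurvature ℳ (blockM x sx tx) (blockA r s t) [i, i + 1]
      = ℳ.massey3 x (r i) (r (i + 1)) sx (s i) + ev ℳ.m [] tx := by
  simp [leftCurvature, sum2_nil, sum2_cons, blockM, blockA, blockSum, RightModule.massey3]
  abel

theorem leftCurvature_three :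
    leftCurvature ℳ (blockM x sx tx) (blockA r s t) [i, i + 1, i + 2]
      = ℳ.massey4 x (r i) (r (i + 1)) (r (i + 2)) sx (s i) (s (i + 1)) tx (t i) := by
  simp [leftCurvature, sum2_nil, sum2_cons, blockM, blockA, blockSum, RightModule.massey4]
  abel

theorem rightCurvature_zero :
    rightCurvature 𝒩 (blockA r s t) (blockM y sy ty) [] = ev 𝒩.m [] y := by
  simp [rightCurvature, sum2_nil, blockM]

theorem rightCurvature_one :
    rightCurvature 𝒩 (blockA r s t) (blockM y sy ty) [i] = ev 𝒩.m [r i] y + ev 𝒩.m [] sy := by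
  simp [rightCurvature, sum2_nil, sum2_cons, blockM, blockA, blockSum, add_comm]

theorem rightCurvature_two :
    rightCurvature 𝒩 (blockA r s t) (blockM y sy ty) [i, i + 1]
      = 𝒩.massey3 (r i) (r (i + 1)) y (s i) sy + ev 𝒩.m [] ty := by
  simp [rightCurvature, sum2_nil, sum2_cons, blockM, blockA, blockSum, LeftModule.massey3]
  abel

theorem rightCurvature_three :
    rightCurvature 𝒩 (blockA r s t) (blockM y sy ty) [i, i + 1, i + 2]
      = 𝒩.massey4 (r i) (r (i + 1)) (r (i + 2)) y (s i) (s (i + 1)) sy (t i) ty := by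
  simp [rightCurvature, sum2_nil, sum2_cons, blockM, blockA, blockSum, LeftModule.massey4]
  abel

theorem take_range' (j i n : ℕ) : (List.range' i n).take j = List.range' i (min j n) :=
  List.ext_getElem (by simp) fun k _ _ => by simp

/-- The curvatures are computed on lists `i, i + 1, …`. This brings every sublist of `1, …, n` to
that form, with the bounds under which the equations for the chains are available. -/
theorem eq_range'_of_infix {v : List ℕ} {n : ℕ} (h : v <:+: List.range' 1 n) :
    ∃ i, 1 ≤ i ∧ i + v.length ≤ n + 1 ∧ v = List.range' i v.length := by
  obtain ⟨u, w, h⟩ := h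
  have hl := congrArg List.length h
  simp only [List.length_append, List.length_range'] at hl
  refine ⟨1 + u.length, by omega, by omega, ?_⟩
  have h1 := congrArg (fun l => (l.drop u.length).take v.length) h
  simpa [List.append_assoc, List.drop_range', take_range', ← hl, add_assoc] using h1

theorem eq_range'_of_prefix {u : List ℕ} {n : ℕ} (h : u <+: List.range' 1 n) :
    u.length ≤ n ∧ u = List.range' 1 u.length := by
  have hl := h.length_le
  rw [List.length_range'] at hl
  refine ⟨hl, ?_⟩
  conv_lhs => rw [List.prefix_iff_eq_take.1 h, take_range', min_eq_left hl]

theorem eq_range'_of_suffix {w : List ℕ} {n : ℕ} (h : w <:+ List.range' 1 n) :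
    w.length ≤ n ∧ w = List.range' (n + 1 - w.length) w.length := by
  have hl := h.length_le
  rw [List.length_range'] at hl
  refine ⟨hl, ?_⟩
  conv_lhs => rw [List.suffix_iff_eq_drop.1 h, List.drop_range']
  rw [List.length_range', show 1 + (n - w.length) * 1 = n + 1 - w.length by omega,
    Nat.sub_sub_self hl]

/-- The boundary of the total chain of `1, …, n` up to lower filtration. -/
theorem boundary_totalChain_range'_sub_mem {bM : List ℕ → M} {bA : List ℕ → A}
    {bN : List ℕ → N} {n k : ℕ} (hk : k ≤ n)
    (hM : ∀ u, u <+: List.range' 1 n → u.length < k → leftCurvature ℳ bM bA u = 0)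
    (hA : ∀ v, v <:+: List.range' 1 n → v.length ≤ k → curvature 𝒜 bA v = 0)
    (hN : ∀ w, w <:+ List.range' 1 n → w.length < k → rightCurvature 𝒩 bA bN w = 0) :
    boundary ℳ 𝒩 (totalChain bM bA bN (List.range' 1 n))
      - (word (leftCurvature ℳ bM bA (List.range' 1 k))
            (seg (fun a => bA [a]) (1 + k) (n - k)) (bN [])
        + ∑ i ∈ Finset.Icc 1 (n - k), word (bM [])
            (seg (fun a => bA [a]) 1 (i - 1) ++ curvature 𝒜 bA (List.range' i (k + 1)) ::
              seg (fun a => bA [a]) (i + (k + 1)) (n - (i + k))) (bN [])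
        + word (bM []) (seg (fun a => bA [a]) 1 (n - k))
            (rightCurvature 𝒩 bA bN (List.range' (1 + (n - k)) k)))
      ∈ boxFil A M N (n - k - 1) := by
  have h := boundary_totalChain_sub_mem_boxFil ℳ 𝒩 bM bA bN (r := k) (by simpa using hk) hM hA hN
  rw [List.length_range'] at h
  convert h using 2
  refine congrArg₂ _ (congrArg₂ _ ?_ ?_) ?_
  · rw [take_range', min_eq_left hk, List.drop_range', mul_one]
    rfl
  -- List positions start at `0` while the entries `r₁, …, rₙ` are numbered from `1`.
  · rw [show Finset.Icc 1 (n - k) = Finset.Ico (0 + 1) (n - k + 1) from rfl,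
      ← Finset.sum_Ico_add', Finset.range_eq_Ico]
    refine Finset.sum_congr rfl fun i hi => ?_
    rw [Finset.mem_Ico] at hi
    rw [take_range', min_eq_left (by omega), List.drop_range', List.drop_range', take_range',
      min_eq_left (by omega), mul_one, mul_one, add_tsub_cancel_right, seg, seg,
      show 1 + i = i + 1 from add_comm _ _,
      show 1 + (i + (k + 1)) = i + 1 + (k + 1) by omega,
      show n - (i + (k + 1)) = n - (i + 1 + k) by omega]
  · rw [take_range', min_eq_left (by omega), List.drop_range', mul_one, Nat.sub_sub_self hk]
    rfl

end Blocks

/-! ### Existence of homogeneous bounding chains -/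

namespace CycleWord

variable {ℳ : RightModule 𝒜 M} {𝒩 : LeftModule 𝒜 N} {n : ℕ} {c : CycleWord ℳ 𝒩 n}

theorem sum_map_range' (f : ℕ → ℤ) (n : ℕ) :
    ((List.range' 1 n).map f).sum = ∑ i ∈ Finset.Icc 1 n, f i := by
  induction n with
  | zero => simp
  | succ n ih =>
    rw [List.range'_concat, Finset.sum_Icc_succ_top (by omega), ← ih]
    simp [add_comm]

theorem nonempty_boundingChains (hn : 1 ≤ n) (h : c.ProductsVanish) :
    Nonempty c.BoundingChains := by
  obtain ⟨⟨sx, hsx⟩, hs, ⟨sy, hsy⟩⟩ := h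
  have hl : ∃ s ∈ ℳ.grade (c.dx + c.d 1 - 1), ev ℳ.m [] s = ev ℳ.m [c.r 1] c.x := by
    rw [← hsx]
    refine exists_homogeneous_preimage ℳ.isInternal (ev ℳ.m []) (k := 1) (fun i v hv => ?_) ?_
    · simpa using m_mem_list ℳ (l := []) (ds := []) .nil hv
    · rw [hsx]
      have := m_mem_list ℳ (l := [c.r 1]) (ds := [c.d 1])
        (.cons (c.r_mem 1 le_rfl hn) .nil) c.x_mem
      simpa using this
  have hr : ∃ s ∈ 𝒩.grade (c.d n + c.dy - 1), ev 𝒩.m [] s = ev 𝒩.m [c.r n] c.y := by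
    rw [← hsy]
    refine exists_homogeneous_preimage 𝒩.isInternal (ev 𝒩.m []) (k := 1) (fun i v hv => ?_) ?_
    · simpa using n_mem_list 𝒩 (l := []) (ds := []) .nil hv
    · rw [hsy]
      have := n_mem_list 𝒩 (l := [c.r n]) (ds := [c.d n])
        (.cons (c.r_mem n hn le_rfl) .nil) c.y_mem
      simpa [add_comm] using this
  have hm : ∀ i, ∃ s, 1 ≤ i → i + 1 ≤ n → s ∈ 𝒜.grade (c.d i + c.d (i + 1) - 1) ∧
      ev 𝒜.μ [s] = ev 𝒜.μ [c.r i, c.r (i + 1)] := by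
    intro i
    by_cases hi : 1 ≤ i ∧ i + 1 ≤ n
    · obtain ⟨s, hs⟩ := hs i hi.1 hi.2
      -- Over the field with two elements additivity already makes `μ₁` linear.
      let f : A →ₗ[F2] A :=
        (AddMonoidHom.mk' (fun a => ev 𝒜.μ [a])
          fun a b => ev_multiadditive 𝒜.μ [] [] a b).toZModLinearMap 2
      obtain ⟨s', h1, h2⟩ := exists_homogeneous_preimage 𝒜.isInternal f (k := 1)
        (i := c.d i + c.d (i + 1) - 1) (s := s) (fun i v hv => by
          have := μ_mem_list (𝒜 := 𝒜) (l := [v]) (ds := [i]) (.cons hv .nil)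
          simp only [List.sum_cons, List.sum_nil, List.length_cons, List.length_nil] at this
          change ev 𝒜.μ [v] ∈ _
          convert this using 2
          push_cast
          ring) (by
          change ev 𝒜.μ [s] ∈ _
          rw [hs]
          have := μ_mem_list (𝒜 := 𝒜) (l := [c.r i, c.r (i + 1)]) (ds := [c.d i, c.d (i + 1)])
            (.cons (c.r_mem i hi.1 (by omega)) (.cons (c.r_mem (i + 1) (by omega) hi.2) .nil))
          simpa using this)
      exact ⟨s', fun _ _ => ⟨h1, h2.trans hs⟩⟩
    -- Outside the relevant range the sequence `s` takes an arbitrary value.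
    · exact ⟨0, fun h1 h2 => absurd ⟨h1, h2⟩ hi⟩
  obtain ⟨sx, h1, h2⟩ := hl
  obtain ⟨sy, h3, h4⟩ := hr
  choose s h5 using hm
  exact ⟨sx, s, sy, h1, fun i hi hi' => (h5 i hi hi').1, h3, h2, fun i hi hi' => (h5 i hi hi').2, h4⟩

/-! ### The defining system of pairs and the differential `d₂` -/

namespace BoundingChains

variable (S : c.BoundingChains) (tx : M) (t : ℕ → A) (ty : N)

/-- The sum of all words obtained from `[x | r₁ | ⋯ | rₙ | y]` by replacing disjoint consecutive
pairs and triples by the chains `s` and `t`. -/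
def fullChain : Box A M N :=
  totalChain (blockM c.x S.sx tx) (blockA c.r S.s t) (blockM c.y S.sy ty) (List.range' 1 n)

theorem fullChain_mem_boxFil : S.fullChain tx t ty ∈ boxFil A M N n := by
  have h := totalChain_mem_boxFil (blockM c.x S.sx tx) (blockA c.r S.s t) (blockM c.y S.sy ty)
    (List.range' 1 n)
  rwa [List.length_range'] at h

theorem fullChain_sub_chain_mem_boxFil :
    S.fullChain tx t ty - c.chain ∈ boxFil A M N (n - 1) := by
  have h := totalChain_sub_mem_boxFil (blockM c.x S.sx tx) (blockA c.r S.s t)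
    (blockM c.y S.sy ty) (List.range' 1 n)
  rw [List.length_range'] at h
  exact h

variable {tx t ty}

/-- The degrees prescribed for `s` and `t` are the sums of shifted degrees over their runs, with the
shift undone for chains in `A`. Longer blocks are zero and belong to every degree. -/
theorem fullChain_mem_boxGrade (hn : 2 ≤ n)
    (htx : tx ∈ ℳ.grade (c.dx + c.d 1 + c.d 2 - 2))
    (ht : ∀ i, 1 ≤ i → i + 2 ≤ n → t i ∈ 𝒜.grade (c.d i + c.d (i + 1) + c.d (i + 2) - 2))
    (hty : ty ∈ 𝒩.grade (c.d (n - 1) + c.d n + c.dy - 2)) :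
    S.fullChain tx t ty ∈ boxGrade ℳ 𝒩 c.degree := by
  have h := totalChain_mem_boxGrade ℳ 𝒩 (blockM c.x S.sx tx) (blockA c.r S.s t)
    (blockM c.y S.sy ty) (L := List.range' 1 n) (dx := c.dx) (wt := fun i => c.d i - 1)
    (dy := c.dy) ?_ ?_ ?_
  · rw [sum_map_range'] at h
    exact h
  · intro u hu
    obtain ⟨hl, h⟩ := eq_range'_of_prefix hu
    rcases u with _ | ⟨a, _ | ⟨b, _ | ⟨d, u⟩⟩⟩
    · simpa [blockM] using c.x_mem
    · simp [List.range'_succ] at h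
      subst h
      have := S.sx_mem
      simp only [blockM, List.map_cons, List.map_nil, List.sum_cons, List.sum_nil]
      convert this using 2
      push_cast
      ring
    · simp [List.range'_succ] at h
      obtain ⟨rfl, rfl⟩ := h
      simp only [blockM, List.map_cons, List.map_nil, List.sum_cons, List.sum_nil]
      convert htx using 2
      push_cast
      ring
    · exact Submodule.zero_mem _
  · intro v hv
    obtain ⟨i, hi, hl, h⟩ := eq_range'_of_infix hv
    rcases v with _ | ⟨a, _ | ⟨b, _ | ⟨d, _ | ⟨e, v⟩⟩⟩⟩
    · exact Submodule.zero_mem _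
    · simp [List.range'_succ] at h hl
      subst h
      simpa [blockA] using c.r_mem a hi hl
    · simp [List.range'_succ] at h hl
      obtain ⟨rfl, rfl⟩ := h
      simp only [blockA, List.map_cons, List.map_nil, List.sum_cons, List.sum_nil]
      convert S.s_mem a hi (by omega) using 2
      ring
    · simp [List.range'_succ] at h hl
      obtain ⟨rfl, rfl, rfl⟩ := h
      simp only [blockA, List.map_cons, List.map_nil, List.sum_cons, List.sum_nil]
      convert ht a hi (by omega) using 2
      ring
    · exact Submodule.zero_mem _
  · intro w hw
    obtain ⟨hl, h⟩ := eq_range'_of_suffix hw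
    rcases w with _ | ⟨a, _ | ⟨b, _ | ⟨d, w⟩⟩⟩
    · simpa [blockM] using c.y_mem
    · simp [List.range'_succ] at h
      subst h
      simp only [blockM, List.map_cons, List.map_nil, List.sum_cons, List.sum_nil]
      convert S.sy_mem using 2
      push_cast
      ring
    · simp [List.range'_succ] at h
      obtain ⟨rfl, rfl⟩ := h
      simp only [blockM, List.map_cons, List.map_nil, List.sum_cons, List.sum_nil]
      -- The last index appears as `n - 1 + 1`, with truncated subtraction.
      rw [Nat.sub_add_cancel (by omega)]
      convert hty using 2
      push_cast
      ring
    · exact Submodule.zero_mem _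

theorem leftCurvature_eq_zero {u : List ℕ} (hu : u <+: List.range' 1 n) (hl : u.length < 2) :
    leftCurvature ℳ (blockM c.x S.sx tx) (blockA c.r S.s t) u = 0 := by
  obtain ⟨-, h⟩ := eq_range'_of_prefix hu
  rcases u with _ | ⟨a, _ | ⟨b, u⟩⟩
  · rw [leftCurvature_zero, c.x_cycle]
  · simp [List.range'_succ] at h
    subst h
    rw [leftCurvature_one, S.sx_eq, ZModModule.add_self]
  · simp at hl

theorem curvature_eq_zero {v : List ℕ} (hv : v <:+: List.range' 1 n) (hl : v.length ≤ 2) :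
    curvature 𝒜 (blockA c.r S.s t) v = 0 := by
  obtain ⟨i, hi, hn, h⟩ := eq_range'_of_infix hv
  rcases v with _ | ⟨a, _ | ⟨b, _ | ⟨d, v⟩⟩⟩
  · exact curvature_nil _
  · simp [List.range'_succ] at h hn
    subst h
    rw [curvature_blockA_one, c.r_cycle a hi hn]
  · simp [List.range'_succ] at h hn
    obtain ⟨rfl, rfl⟩ := h
    rw [curvature_blockA_two, S.s_eq a hi (by omega), ZModModule.add_self]
  · simp at hl

theorem rightCurvature_eq_zero {w : List ℕ} (hw : w <:+ List.range' 1 n) (hl : w.length < 2) :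
    rightCurvature 𝒩 (blockA c.r S.s t) (blockM c.y S.sy ty) w = 0 := by
  obtain ⟨-, h⟩ := eq_range'_of_suffix hw
  rcases w with _ | ⟨a, _ | ⟨b, w⟩⟩
  · rw [rightCurvature_zero, c.y_cycle]
  · simp [List.range'_succ] at h
    subst h
    rw [rightCurvature_one, S.sy_eq, ZModModule.add_self]
  · simp at hl

/-- All chains for triples are set to zero. The curvature of a triple is then exactly the
representative of its Massey product, and it is the first curvature that may be nonzero. -/
theorem exists_represents_masseySum (hn : 2 ≤ n) :
    ∃ e : (tensor ℳ 𝒩).Page 2 n c.degree, (tensor ℳ 𝒩).Represents c.chain e ∧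
      (tensor ℳ 𝒩).Represents S.masseySum ((tensor ℳ 𝒩).dPage 2 n c.degree e) := by
  -- Writing `n = k + 2` lets the truncated differences `n - 1` and `n - 2` in the Massey terms
  -- reduce by computation.
  obtain ⟨k, rfl⟩ := Nat.exists_eq_add_of_le' hn
  have hM := fun u => S.leftCurvature_eq_zero (tx := 0) (t := 0) (u := u)
  have hA := fun v hv hl => S.curvature_eq_zero (t := 0) (v := v) hv hl
  have hN := fun w => S.rightCurvature_eq_zero (ty := 0) (t := 0) (w := w)
  refine (tensor ℳ 𝒩).exists_represents (c := S.fullChain 0 0 0) (S.fullChain_mem_boxFil _ _ _)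
    (S.fullChain_mem_boxGrade hn (zero_mem _) (fun _ _ _ => zero_mem _) (zero_mem _)) ?_
    (S.fullChain_sub_chain_mem_boxFil _ _ _) ?_
  · have := boundary_totalChain_mem_boxFil ℳ 𝒩 _ _ _ hM hA hN
    rw [List.length_range'] at this
    exact this
  · have h := boundary_totalChain_range'_sub_mem hn hM hA hN
    have e1 : leftCurvature ℳ (blockM c.x S.sx 0) (blockA c.r S.s 0) (List.range' 1 2)
        = S.tripleLeft := by
      refine (leftCurvature_two _ _ _ _ _ _ 1).trans ?_
      rw [map_zero, add_zero]
      rfl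
    have e2 : ∀ i, curvature 𝒜 (blockA c.r S.s 0) (List.range' i (2 + 1)) = S.triple i := by
      intro i
      refine (curvature_blockA_three _ _ _ i).trans ?_
      rw [Pi.zero_apply, ev_cons_zero_nil, add_zero]
      rfl
    have e3 : rightCurvature 𝒩 (blockA c.r S.s 0) (blockM c.y S.sy 0)
        (List.range' (1 + (k + 2 - 2)) 2) = S.tripleRight := by
      rw [Nat.add_sub_cancel, add_comm 1 k]
      refine (rightCurvature_two _ _ _ _ _ _ (k + 1)).trans ?_
      rw [map_zero, add_zero]
      rfl
    simp only [e1, e2, e3] at h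
    exact h

end BoundingChains

/-! ### The defining system of triples and the differential `d₃` -/

namespace SecondBoundingChains

variable (T : c.SecondBoundingChains)

theorem leftCurvature_eq_zero {u : List ℕ} (hu : u <+: List.range' 1 n)
    (hl : u.length < 3) :
    leftCurvature ℳ (blockM c.x T.sx T.tx) (blockA c.r T.s T.t) u = 0 := by
  rcases Nat.lt_succ_iff_lt_or_eq.1 hl with h | h
  · exact T.toBoundingChains.leftCurvature_eq_zero hu h
  · rw [(eq_range'_of_prefix hu).2, h]
    refine (leftCurvature_two _ _ _ _ _ _ 1).trans ?_
    rw [T.tx_eq]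
    exact ZModModule.add_self _

theorem curvature_eq_zero {v : List ℕ} (hv : v <:+: List.range' 1 n) (hl : v.length ≤ 3) :
    curvature 𝒜 (blockA c.r T.s T.t) v = 0 := by
  rcases Nat.lt_succ_iff_lt_or_eq.1 (Nat.lt_succ_of_le hl) with h | h
  · exact T.toBoundingChains.curvature_eq_zero hv (Nat.le_of_lt_succ h)
  · obtain ⟨i, hi, hn, hv⟩ := eq_range'_of_infix hv
    rw [hv, h]
    refine (curvature_blockA_three _ _ _ i).trans ?_
    rw [T.t_eq i hi (by omega)]
    exact ZModModule.add_self _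

theorem rightCurvature_eq_zero (hn : 2 ≤ n) {w : List ℕ} (hw : w <:+ List.range' 1 n)
    (hl : w.length < 3) :
    rightCurvature 𝒩 (blockA c.r T.s T.t) (blockM c.y T.sy T.ty) w = 0 := by
  rcases Nat.lt_succ_iff_lt_or_eq.1 hl with h | h
  · exact T.toBoundingChains.rightCurvature_eq_zero hw h
  · rw [(eq_range'_of_suffix hw).2, h]
    obtain ⟨k, rfl⟩ := Nat.exists_eq_add_of_le' hn
    refine (rightCurvature_two _ _ _ _ _ _ (k + 1)).trans ?_
    rw [T.ty_eq]
    exact ZModModule.add_self _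

/-- Including the chains `t` kills the curvatures of size three as well, a gain of one filtration
step. It serves both for `d₂ = 0` and for membership in `Z³`. -/
theorem boundary_fullChain_mem_boxFil (hn : 2 ≤ n) :
    boundary ℳ 𝒩 (T.fullChain T.tx T.t T.ty) ∈ boxFil A M N (n - 3) := by
  have := boundary_totalChain_mem_boxFil ℳ 𝒩 _ _ _ (fun _ => T.leftCurvature_eq_zero)
    (fun _ hv hl => T.curvature_eq_zero hv hl) (fun _ => T.rightCurvature_eq_zero hn)
  rw [List.length_range'] at this
  exact this

theorem fullChain_mem_boxGrade (hn : 2 ≤ n) :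
    T.fullChain T.tx T.t T.ty ∈ boxGrade ℳ 𝒩 c.degree :=
  T.toBoundingChains.fullChain_mem_boxGrade hn T.tx_mem T.t_mem T.ty_mem

theorem exists_represents_dPage_eq_zero (T : c.SecondBoundingChains) (hn : 2 ≤ n) :
    ∃ e : (tensor ℳ 𝒩).Page 2 n c.degree, (tensor ℳ 𝒩).Represents c.chain e ∧
      (tensor ℳ 𝒩).dPage 2 n c.degree e = 0 :=
  (tensor ℳ 𝒩).exists_represents_dPage_eq_zero (T.fullChain_mem_boxFil _ _ _)
    (T.fullChain_mem_boxGrade hn)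
    (by rw [sub_sub]; exact T.boundary_fullChain_mem_boxFil hn)
    (T.fullChain_sub_chain_mem_boxFil _ _ _)

theorem exists_represents_fourfoldMasseySum (hn : 3 ≤ n) :
    ∃ e : (tensor ℳ 𝒩).Page 3 n c.degree, (tensor ℳ 𝒩).Represents c.chain e ∧
      (tensor ℳ 𝒩).Represents T.fourfoldMasseySum ((tensor ℳ 𝒩).dPage 3 n c.degree e) := by
  have hn' : 2 ≤ n := by omega
  obtain ⟨k, rfl⟩ := Nat.exists_eq_add_of_le' hn
  refine (tensor ℳ 𝒩).exists_represents (T.fullChain_mem_boxFil _ _ _)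
    (T.fullChain_mem_boxGrade hn') (T.boundary_fullChain_mem_boxFil hn')
    (T.fullChain_sub_chain_mem_boxFil _ _ _) ?_
  have h := boundary_totalChain_range'_sub_mem hn (fun _ => T.leftCurvature_eq_zero)
    (fun _ hv hl => T.curvature_eq_zero hv hl) (fun _ => T.rightCurvature_eq_zero hn')
  have e1 : leftCurvature ℳ (blockM c.x T.sx T.tx) (blockA c.r T.s T.t) (List.range' 1 3)
      = T.quadrupleLeft := leftCurvature_three _ _ _ _ _ _ 1
  have e2 : ∀ i, curvature 𝒜 (blockA c.r T.s T.t) (List.range' i (3 + 1)) = T.quadruple i :=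
    curvature_blockA_four _ _ _
  have e3 : rightCurvature 𝒩 (blockA c.r T.s T.t) (blockM c.y T.sy T.ty)
      (List.range' (1 + (k + 3 - 3)) 3) = T.quadrupleRight := by
    rw [Nat.add_sub_cancel, add_comm 1 k]
    exact rightCurvature_three _ _ _ _ _ _ (k + 1)
  simp only [e1, e2, e3] at h
  exact h

end SecondBoundingChains
end CycleWord

end AInf

end

theorem mainTheorem8 {A M N : Type*} [AddCommGroup A] [Module AInf.F2 A]
    [AddCommGroup M] [Module AInf.F2 M] [AddCommGroup N] [Module AInf.F2 N]
    {𝒜 : AInf.Algebra A} (ℳ : AInf.RightModule 𝒜 M) (𝒩 : AInf.LeftModule 𝒜 N)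
    (n : ℕ) (c : AInf.CycleWord ℳ 𝒩 n) :
    (2 ≤ n → c.ProductsVanish →
      Nonempty c.BoundingChains ∧
      ∃ e : (AInf.tensor ℳ 𝒩).Page 2 n c.degree,
        (AInf.tensor ℳ 𝒩).Represents c.chain e ∧
        ∀ S : c.BoundingChains,
          (AInf.tensor ℳ 𝒩).Represents S.masseySum
            ((AInf.tensor ℳ 𝒩).dPage 2 n c.degree e)) ∧
    (3 ≤ n → Nonempty c.SecondBoundingChains →
      (∃ e : (AInf.tensor ℳ 𝒩).Page 2 n c.degree,
        (AInf.tensor ℳ 𝒩).Represents c.chain e ∧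
        (AInf.tensor ℳ 𝒩).dPage 2 n c.degree e = 0) ∧
      ∃ e : (AInf.tensor ℳ 𝒩).Page 3 n c.degree,
        (AInf.tensor ℳ 𝒩).Represents c.chain e ∧
        ∀ T : c.SecondBoundingChains,
          (AInf.tensor ℳ 𝒩).Represents T.fourfoldMasseySum
            ((AInf.tensor ℳ 𝒩).dPage 3 n c.degree e)) := by
  refine ⟨fun hn h => ?_, fun hn ⟨T⟩ => ?_⟩
  · obtain ⟨S⟩ := AInf.CycleWord.nonempty_boundingChains (by omega) h
    obtain ⟨e, he, -⟩ := S.exists_represents_masseySum hn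
    refine ⟨⟨S⟩, e, he, fun S' => ?_⟩
    obtain ⟨e', he', h'⟩ := S'.exists_represents_masseySum hn
    -- The class built from another choice of bounding chains is represented by the same word, hence
    -- equals `e`; so one `e` serves all choices.
    rwa [he.unique _ he']
  · obtain ⟨e, he, -⟩ := T.exists_represents_fourfoldMasseySum hn
    refine ⟨T.exists_represents_dPage_eq_zero (by omega), e, he, fun T' => ?_⟩
    obtain ⟨e', he', h'⟩ := T'.exists_represents_fourfoldMasseySum hn
    rwa [he.unique _ he']
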